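/- **Setting.** Let $\mathcal B$ be a bicategory. For $X\in\mathcal B(a,b)$ and $Y\in\mathcal B(b,c)$ write $Y\otimes X\in\mathcal B(a,c)$ for the composite, and $I_a$ for the unit 1-morphism of $a$. $\mathcal B$ is *pivotal* if every $X\in\mathcal B(a,b)$ comes with $X^\dagger\in\mathcal B(b,a)$ and chosen adjunctions $X^\dagger\dashv X$, with maps $\mathrm{ev}_X: X^\dagger\otimes X\to I_a$ and $\mathrm{coev}_X: I_b\to X\otimes X^\dagger$, and $X\dashv X^\dagger$, with maps $\widetilde{\mathrm{ev}}_X: X\otimes X^\dagger\to I_b$ and $\widetilde{\mathrm{coev}}_X: I_a\to X^\dagger\otimes X$, such that (suppressing associators and units) - for every 2-morphism $\phi: Z\to X$ the two induced 2-morphisms $X^\dagger\to Z^\dagger$ agree, i.e. $(1\otimes\widetilde{\mathrm{ev}}_X)\circ(1\otimes\phi\otimes 1)\circ(\widetilde{\mathrm{coev}}_Z\otimes 1)=(\mathrm{ev}_X\otimes 1)\circ(1\otimes\phi\otimes1)\circ(1\otimes\mathrm{coev}_Z)$; - for composable $X,Y$ the two canonical 2-morphisms $(Y\otimes X)^\dagger\to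 X^\dagger\otimes Y^\dagger$, one built from $\widetilde{\mathrm{coev}}_X,\widetilde{\mathrm{coev}}_Y,\widetilde{\mathrm{ev}}_{Y\otimes X}$ and the other from $\mathrm{coev}_X,\mathrm{coev}_Y,\mathrm{ev}_{Y\otimes X}$, agree. The *right quantum dimension* of $X\in\mathcal B(a,b)$ is $\dim_{\mathrm r}(X)=\widetilde{\mathrm{ev}}_X\circ\mathrm{coev}_X\in\mathrm{End}(I_b)$. A *Frobenius algebra* in $\mathcal B(a,a)$ is $A\in\mathcal B(a,a)$ with an associative unital product $(\mu,\eta)$ and a coassociative counital coproduct $(\Delta,\varepsilon)$ such that $(1\otimes\mu)\circ(\Delta\otimes1)=\Delta\circ\mu=(\mu\otimes1)\circ(1\otimes\Delta)$. It is *separable* if $\mu\circ\Delta=1_A$ and, when $\mathcal B$ is pivotal, *symmetric* if $((\varepsilon\circ\mu)\otimes1)\circ(1\otimes\mathrm{coev}_A)=(1\otimes(\varepsilon\circ\mu))\circ(\widetilde{\mathrm{coev}}_A\otimes1)$ as 2-morphisms $A\to A^\dagger$. Each $I_b$ is a separable Frobenius algebra via the unit isomorphisms. If $\mathcal B$ has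 idempotent complete hom-categories, its *equivariant completion* $\mathcal B_{\mathrm{eq}}$ is the bicategory whose objects are pairs $(a,A)$ with $A\in\mathcal B(a,a)$ a separable Frobenius algebra, whose 1-morphisms $(a,A)\to(b,B)$ are $B$-$A$-bimodules $X\in\mathcal B(a,b)$, whose 2-morphisms are bimodule maps, whose composition of 1-morphisms is the tensor product over the intermediate algebra (the coequaliser of its two actions), and in which the unit 1-morphism of $(a,A)$ is $A$. If $\mathcal B$ is moreover pivotal, its *orbifold completion* $\mathcal B_{\mathrm{orb}}$ is the full subbicategory of $\mathcal B_{\mathrm{eq}}$ on those $(a,A)$ with $A$ symmetric. **Theorem.** Let $\mathcal B$ be a pivotal bicategory with idempotent complete hom-categories, and let $X\in\mathcal B(a,b)$ be such that $\dim_{\mathrm r}(X)$ is invertible. Then $A:=X^\dagger\otimes X$ with $$\mu=1_{X^\dagger}\otimes\widetilde{\mathrm{ev}}_X\otimes1_X,\quad \eta=\widetilde{\mathrm{coev}}_X,\quad \Delta=1_{X^\dagger}\otimes\big(\mathrm{coev}_X\circ\dim_{\mathrm r}(X)^{-1}\big)\otimes1_X,\quad \varepsilon=\mathrm{ev}_X\circ\big(1_{X^\dagger}\otimes\dim_{\mathrm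 r}(X)\otimes1_X\big)$$ is a symmetric separable Frobenius algebra in $\mathcal B(a,a)$. Moreover $X$ is an $I_b$-$A$-bimodule and $X^\dagger$ is an $A$-$I_b$-bimodule, where $A$ acts via $\widetilde{\mathrm{ev}}_X$ and $I_b$ acts via the unit isomorphisms, and there is an adjoint equivalence in $\mathcal B_{\mathrm{eq}}$ between $(a,A)$ and $(b,I_b)$ whose 1-morphisms are $X:(a,A)\to(b,I_b)$ and $X^\dagger:(b,I_b)\to(a,A)$. The algebra $I_b$ is symmetric as well, so that $(a,A)$ and $(b,I_b)$ are objects of $\mathcal B_{\mathrm{orb}}$, and $X$, $X^\dagger$ also form an adjoint equivalence between them in $\mathcal B_{\mathrm{orb}}$. -/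

import Mathlib

open CategoryTheory Bicategory

universe w v u

namespace Orbifold

/-!
# Equivariant and orbifold completion of a bicategory

Conventions.  The composite `X ≫ Y` of `X : a ⟶ b` and `Y : b ⟶ c` is the 1-morphism usually
written `Y ⊗ X : a → c`.  All tensor products are therefore written here in diagrammatic order;
in particular the product `X† ⊗ X` in `B(a, a)` of `X : a ⟶ b` and `X† : b ⟶ a` reads `X ≫ X†`,
and a right action `X ⊗ A ⟶ X` of `A : a ⟶ a` on `X : a ⟶ b` reads `A ≫ X ⟶ X`.
-/

section Algebras

variable {B : Type u} [Bicategory.{w, v} B]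

/-- The data of an algebra and a coalgebra structure on an endo-1-morphism `A : a ⟶ a`, that is, on
an object `A` of the monoidal category `B(a, a)`. -/
structure FrobData {a : B} (A : a ⟶ a) where
  mul : A ≫ A ⟶ A
  one : 𝟙 a ⟶ A
  comul : A ⟶ A ≫ A
  counit : A ⟶ 𝟙 a

namespace FrobData

variable {a : B} {A : a ⟶ a}

/-- `A` is a Frobenius algebra: it is an associative unital algebra and a coassociative counital
coalgebra, and `(1 ⊗ μ) ∘ (Δ ⊗ 1) = Δ ∘ μ = (μ ⊗ 1) ∘ (1 ⊗ Δ)`. -/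
structure IsFrobenius (F : FrobData A) : Prop where
  mul_assoc : F.mul ▷ A ≫ F.mul = (α_ A A A).hom ≫ A ◁ F.mul ≫ F.mul
  one_mul : F.one ▷ A ≫ F.mul = (λ_ A).hom
  mul_one : A ◁ F.one ≫ F.mul = (ρ_ A).hom
  comul_assoc : F.comul ≫ F.comul ▷ A ≫ (α_ A A A).hom = F.comul ≫ A ◁ F.comul
  counit_comul : F.comul ≫ F.counit ▷ A = (λ_ A).inv
  comul_counit : F.comul ≫ A ◁ F.counit = (ρ_ A).inv
  frobenius_left : A ◁ F.comul ≫ (α_ A A A).inv ≫ F.mul ▷ A = F.mul ≫ F.comul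
  frobenius_right : F.comul ▷ A ≫ (α_ A A A).hom ≫ A ◁ F.mul = F.mul ≫ F.comul

/-- `A` is (`Δ`-)separable: `μ ∘ Δ = 1`. -/
def IsSeparable (F : FrobData A) : Prop := F.comul ≫ F.mul = 𝟙 A

/-- The unit 1-morphism `I_a` with its canonical algebra and coalgebra structure. -/
def unit (a : B) : FrobData (𝟙 a) where
  mul := (λ_ (𝟙 a)).hom
  one := 𝟙 (𝟙 a)
  comul := (λ_ (𝟙 a)).inv
  counit := 𝟙 (𝟙 a)

theorem unit_isFrobenius (a : B) : (unit a).IsFrobenius := by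
  constructor <;> simp only [unit] <;> bicategory

theorem unit_isSeparable (a : B) : (unit a).IsSeparable := by
  simp [IsSeparable, unit]

end FrobData

section Tensor

variable {a b c : B} {A : b ⟶ b} (F : FrobData A) {X : a ⟶ b} {Y : b ⟶ c}

/-- For a right `A`-module structure `r` (on the factor glued along `A`) and a left one `l`, the
endomorphism `π_A` of the tensor product which inserts `Δ ∘ η` between the two modules and
then acts with the two legs of the coproduct. -/
def relIdem (r : X ≫ A ⟶ X) (l : A ≫ Y ⟶ Y) : X ≫ Y ⟶ X ≫ Y :=
  X ◁ (λ_ Y).inv ≫ X ◁ (F.one ≫ F.comul) ▷ Y ≫ X ◁ (α_ A A Y).hom ≫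
    (α_ X A (A ≫ Y)).inv ≫ r ▷ (A ≫ Y) ≫ X ◁ l

variable {F}

theorem balanced_left (hF : F.IsFrobenius) (r : X ≫ A ⟶ X) (l : A ≫ Y ⟶ Y)
    (hr : X ◁ F.mul ≫ r = (α_ X A A).inv ≫ r ▷ A ≫ r) :
    r ▷ Y ≫ relIdem F r l = (α_ X A Y).hom ≫ X ◁ F.comul ▷ Y ≫ X ◁ (α_ A A Y).hom ≫
      (α_ X A (A ≫ Y)).inv ≫ r ▷ (A ≫ Y) ≫ X ◁ l := by
  have key : F.comul = (ρ_ A).inv ≫ A ◁ F.one ≫ A ◁ F.comul ≫ (α_ A A A).inv ≫ F.mul ▷ A := by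
    rw [hF.frobenius_left]; rw [← Category.assoc (A ◁ F.one), hF.mul_one]; simp
  calc
    _ = 𝟙 _ ⊗≫ (r ▷ (𝟙 b ≫ Y) ≫ X ◁ ((F.one ≫ F.comul) ▷ Y)) ⊗≫ r ▷ (A ≫ Y) ≫ X ◁ l := by
      rw [relIdem]; bicategory
    _ = 𝟙 _ ⊗≫ X ◁ A ◁ (F.one ≫ F.comul) ▷ Y ⊗≫ ((α_ X A A).inv ≫ r ▷ A ≫ r) ▷ (A ≫ Y)
          ≫ X ◁ l := by
      rw [← whisker_exchange]; bicategory
    _ = 𝟙 _ ⊗≫ X ◁ ((ρ_ A).inv ≫ A ◁ F.one ≫ A ◁ F.comul ≫ (α_ A A A).inv ≫ F.mul ▷ A) ▷ Y ⊗≫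
          r ▷ (A ≫ Y) ≫ X ◁ l := by
      rw [← hr]; bicategory
    _ = _ := by
      rw [← key]; bicategory

theorem balanced_right (hF : F.IsFrobenius) (r : X ≫ A ⟶ X) (l : A ≫ Y ⟶ Y)
    (hl : F.mul ▷ Y ≫ l = (α_ A A Y).hom ≫ A ◁ l ≫ l) :
    X ◁ l ≫ relIdem F r l = X ◁ F.comul ▷ Y ≫ X ◁ (α_ A A Y).hom ≫
      (α_ X A (A ≫ Y)).inv ≫ r ▷ (A ≫ Y) ≫ X ◁ l := by
  have key : F.comul = (λ_ A).inv ≫ F.one ▷ A ≫ F.comul ▷ A ≫ (α_ A A A).hom ≫ A ◁ F.mul := by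
    rw [hF.frobenius_right]; rw [← Category.assoc (F.one ▷ A), hF.one_mul]; simp
  calc
    _ = 𝟙 _ ⊗≫ X ◁ (𝟙 b ◁ l ≫ (F.one ≫ F.comul) ▷ Y) ⊗≫ (r ▷ (A ≫ Y) ≫ X ◁ l) := by
      rw [relIdem]; bicategory
    _ = 𝟙 _ ⊗≫ X ◁ (𝟙 b ◁ l ≫ (F.one ≫ F.comul) ▷ Y) ⊗≫ ((X ≫ A) ◁ l ≫ r ▷ Y) := by
      rw [whisker_exchange r l]
    _ = 𝟙 _ ⊗≫ X ◁ ((F.one ≫ F.comul) ▷ (A ≫ Y) ≫ (A ≫ A) ◁ l) ⊗≫ ((X ≫ A) ◁ l ≫ r ▷ Y) := by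
      rw [whisker_exchange (F.one ≫ F.comul) l]
    _ = 𝟙 _ ⊗≫ X ◁ (F.one ≫ F.comul) ▷ (A ≫ Y) ⊗≫
          X ◁ A ◁ (A ◁ l ≫ l) ⊗≫ r ▷ Y := by
      bicategory
    _ = 𝟙 _ ⊗≫ X ◁ (F.one ≫ F.comul) ▷ (A ≫ Y) ⊗≫
          X ◁ A ◁ ((α_ A A Y).inv ≫ (α_ A A Y).hom ≫ A ◁ l ≫ l) ⊗≫ r ▷ Y := by
      bicategory
    _ = 𝟙 _ ⊗≫ X ◁ ((λ_ A).inv ≫ F.one ▷ A ≫ F.comul ▷ A ≫ (α_ A A A).hom ≫ A ◁ F.mul) ▷ Y ⊗≫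
          ((X ≫ A) ◁ l ≫ r ▷ Y) := by
      rw [← hl]; bicategory
    _ = _ := by
      rw [← key, whisker_exchange]; bicategory

theorem relIdem_balanced (hF : F.IsFrobenius) (r : X ≫ A ⟶ X) (l : A ≫ Y ⟶ Y)
    (hr : X ◁ F.mul ≫ r = (α_ X A A).inv ≫ r ▷ A ≫ r)
    (hl : F.mul ▷ Y ≫ l = (α_ A A Y).hom ≫ A ◁ l ≫ l) :
    r ▷ Y ≫ relIdem F r l = ((α_ X A Y).hom ≫ X ◁ l) ≫ relIdem F r l := by
  rw [balanced_left hF r l hr, Category.assoc, balanced_right hF r l hl]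

theorem relIdem_desc (hs : F.IsSeparable) (r : X ≫ A ⟶ X) (l : A ≫ Y ⟶ Y)
    (hl : F.mul ▷ Y ≫ l = (α_ A A Y).hom ≫ A ◁ l ≫ l)
    (hl1 : F.one ▷ Y ≫ l = (λ_ Y).hom)
    {W : a ⟶ c} (f : X ≫ Y ⟶ W) (hf : r ▷ Y ≫ f = ((α_ X A Y).hom ≫ X ◁ l) ≫ f) :
    relIdem F r l ≫ f = f := by
  have hs' : F.comul ≫ F.mul = 𝟙 A := hs
  calc
    _ = 𝟙 _ ⊗≫ X ◁ (F.one ≫ F.comul) ▷ Y ⊗≫ (r ▷ (A ≫ Y) ≫ X ◁ l) ⊗≫ f := by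
      rw [relIdem]; bicategory
    _ = 𝟙 _ ⊗≫ X ◁ (F.one ≫ F.comul) ▷ Y ⊗≫ X ◁ A ◁ l ⊗≫ (r ▷ Y ≫ f) := by
      rw [← whisker_exchange]; bicategory
    _ = 𝟙 _ ⊗≫ X ◁ (F.one ≫ F.comul) ▷ Y ⊗≫ X ◁ ((α_ A A Y).hom ≫ A ◁ l ≫ l) ≫ f := by
      rw [hf]; bicategory
    _ = 𝟙 _ ⊗≫ X ◁ (F.one ≫ (F.comul ≫ F.mul)) ▷ Y ⊗≫ X ◁ l ≫ f := by
      rw [← hl]; bicategory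
    _ = 𝟙 _ ⊗≫ X ◁ (F.one ▷ Y ≫ l) ≫ f := by
      rw [hs']; bicategory
    _ = _ := by
      rw [hl1]; bicategory

theorem relIdem_nat_left {X' : a ⟶ b} (r : X ≫ A ⟶ X) (r' : X' ≫ A ⟶ X') (l : A ≫ Y ⟶ Y)
    (g : X ⟶ X') (hg : r ≫ g = g ▷ A ≫ r') :
    relIdem F r l ≫ g ▷ Y = g ▷ Y ≫ relIdem F r' l := by
  calc
    _ = 𝟙 _ ⊗≫ X ◁ (F.one ≫ F.comul) ▷ Y ⊗≫ r ▷ (A ≫ Y) ⊗≫ (X ◁ l ≫ g ▷ Y) := by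
      rw [relIdem]; bicategory
    _ = 𝟙 _ ⊗≫ X ◁ (F.one ≫ F.comul) ▷ Y ⊗≫ (r ≫ g) ▷ (A ≫ Y) ⊗≫ X' ◁ l := by
      rw [whisker_exchange]; bicategory
    _ = 𝟙 _ ⊗≫ (X ◁ ((F.one ≫ F.comul) ▷ Y) ≫ g ▷ ((A ≫ A) ≫ Y)) ⊗≫
          r' ▷ (A ≫ Y) ⊗≫ X' ◁ l := by
      rw [hg]; bicategory
    _ = _ := by
      rw [whisker_exchange, relIdem]; bicategory

theorem relIdem_nat_right {Y' : b ⟶ c} (r : X ≫ A ⟶ X) (l : A ≫ Y ⟶ Y) (l' : A ≫ Y' ⟶ Y')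
    (h : Y ⟶ Y') (hh : l ≫ h = A ◁ h ≫ l') :
    relIdem F r l ≫ X ◁ h = X ◁ h ≫ relIdem F r l' := by
  calc
    _ = 𝟙 _ ⊗≫ X ◁ (F.one ≫ F.comul) ▷ Y ⊗≫ r ▷ (A ≫ Y) ⊗≫ X ◁ (l ≫ h) := by
      rw [relIdem]; bicategory
    _ = 𝟙 _ ⊗≫ X ◁ (F.one ≫ F.comul) ▷ Y ⊗≫ (r ▷ (A ≫ Y) ≫ X ◁ (A ◁ h)) ⊗≫ X ◁ l' := by
      rw [hh]; bicategory
    _ = 𝟙 _ ⊗≫ X ◁ ((F.one ≫ F.comul) ▷ Y ≫ (A ≫ A) ◁ h) ⊗≫ r ▷ (A ≫ Y') ⊗≫ X ◁ l' := by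
      rw [← whisker_exchange]; bicategory
    _ = _ := by
      rw [← whisker_exchange, relIdem]; bicategory

theorem relIdem_comp_left {z : B} (Z : z ⟶ a) (r : X ≫ A ⟶ X) (l : A ≫ Y ⟶ Y) :
    relIdem F ((α_ Z X A).hom ≫ Z ◁ r) l =
      (α_ Z X Y).hom ≫ Z ◁ relIdem F r l ≫ (α_ Z X Y).inv := by
  simp only [relIdem]; bicategory

theorem relIdem_comp_right {z : B} (Z : c ⟶ z) (r : X ≫ A ⟶ X) (l : A ≫ Y ⟶ Y) :
    relIdem F r ((α_ A Y Z).inv ≫ l ▷ Z) =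
      (α_ X Y Z).inv ≫ relIdem F r l ▷ Z ≫ (α_ X Y Z).hom := by
  simp only [relIdem]; bicategory

end Tensor


/-- Bimodules.  For `A : a ⟶ a` and `C : b ⟶ b`, a `C`-`A`-bimodule is a 1-morphism `X : a ⟶ b` with
an action `actS` of the algebra `A` on its source side (in the usual notation a right action
`X ⊗ A ⟶ X`) and an action `actT` of the algebra `C` on its target side (a left action
`C ⊗ X ⟶ X`), both associative and unital, and commuting with each other. -/
structure IsBimodule {a b : B} {A : a ⟶ a} {C : b ⟶ b} (F : FrobData A) (G : FrobData C)
    (X : a ⟶ b) (actS : A ≫ X ⟶ X) (actT : X ≫ C ⟶ X) : Prop where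
  mul_actS : F.mul ▷ X ≫ actS = (α_ A A X).hom ≫ A ◁ actS ≫ actS
  one_actS : F.one ▷ X ≫ actS = (λ_ X).hom
  actT_mul : X ◁ G.mul ≫ actT = (α_ X C C).inv ≫ actT ▷ C ≫ actT
  actT_one : X ◁ G.one ≫ actT = (ρ_ X).hom
  actS_actT : actS ▷ C ≫ actT = (α_ A X C).hom ≫ A ◁ actT ≫ actS

variable (B) in
/-- The objects of the equivariant completion `B_eq`: pairs `(a, A)` of an object `a` of `B` and a
separable Frobenius algebra `A` in `B(a, a)`. -/
structure EqCompletion where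
  pt : B
  alg : pt ⟶ pt
  frob : FrobData alg
  isFrobenius : frob.IsFrobenius
  isSeparable : frob.IsSeparable

namespace EqCompletion

/-- The 1-morphisms `(a, A) ⟶ (b, C)` of `B_eq`: `C`-`A`-bimodules. -/
structure Bimod (S T : EqCompletion B) where
  obj : S.pt ⟶ T.pt
  actS : S.alg ≫ obj ⟶ obj
  actT : obj ≫ T.alg ⟶ obj
  isBimodule : IsBimodule S.frob T.frob obj actS actT

/-- The 2-morphisms of `B_eq`: bimodule maps. -/
@[ext]
structure BimodHom {S T : EqCompletion B} (M N : Bimod S T) where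
  hom : M.obj ⟶ N.obj
  actS_comm : M.actS ≫ hom = S.alg ◁ hom ≫ N.actS
  actT_comm : M.actT ≫ hom = hom ▷ T.alg ≫ N.actT

instance bimodCategory (S T : EqCompletion B) : Category (Bimod S T) where
  Hom M N := BimodHom M N
  id M := { hom := 𝟙 M.obj, actS_comm := by simp, actT_comm := by simp }
  comp f g :=
    { hom := f.hom ≫ g.hom
      actS_comm := by
        rw [← Category.assoc, f.actS_comm, Category.assoc, g.actS_comm]; simp
      actT_comm := by
        rw [← Category.assoc, f.actT_comm, Category.assoc, g.actT_comm]; simp }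

@[ext]
theorem hom₂_ext {S T : EqCompletion B} {M N : Bimod S T} {f g : M ⟶ N} (h : f.hom = g.hom) :
    f = g := BimodHom.ext h

@[simp] theorem id_hom {S T : EqCompletion B} (M : Bimod S T) : BimodHom.hom (𝟙 M) = 𝟙 M.obj := rfl

@[simp] theorem comp_hom {S T : EqCompletion B} {M N P : Bimod S T} (f : M ⟶ N) (g : N ⟶ P) :
    BimodHom.hom (f ≫ g) = f.hom ≫ g.hom := rfl

/-- A bimodule map whose underlying 2-morphism has an inverse is an isomorphism of bimodules. -/
@[simps]
def isoMk {S T : EqCompletion B} {M N : Bimod S T} (f : M ⟶ N) (g : N.obj ⟶ M.obj)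
    (h₁ : f.hom ≫ g = 𝟙 M.obj) (h₂ : g ≫ f.hom = 𝟙 N.obj) : M ≅ N where
  hom := f
  inv :=
    { hom := g
      actS_comm := by
        have h := f.actS_comm
        have e : S.alg ◁ g ≫ S.alg ◁ f.hom = 𝟙 _ := by
          rw [← whiskerLeft_comp, h₂, whiskerLeft_id]
        calc _ = (S.alg ◁ g ≫ S.alg ◁ f.hom) ≫ N.actS ≫ g := by rw [e, Category.id_comp]
          _ = S.alg ◁ g ≫ (S.alg ◁ f.hom ≫ N.actS) ≫ g := by simp only [Category.assoc]
          _ = _ := by rw [← h, Category.assoc, h₁, Category.comp_id]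
      actT_comm := by
        have h := f.actT_comm
        have e : g ▷ T.alg ≫ f.hom ▷ T.alg = 𝟙 _ := by
          rw [← comp_whiskerRight, h₂, id_whiskerRight]
        calc _ = (g ▷ T.alg ≫ f.hom ▷ T.alg) ≫ N.actT ≫ g := by rw [e, Category.id_comp]
          _ = g ▷ T.alg ≫ (f.hom ▷ T.alg ≫ N.actT) ≫ g := by simp only [Category.assoc]
          _ = _ := by rw [← h, Category.assoc, h₁, Category.comp_id] }
  hom_inv_id := hom₂_ext h₁
  inv_hom_id := hom₂_ext h₂

/-- The unit 1-morphism of `(a, A)` is `A` as a bimodule over itself. -/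
def idHom (S : EqCompletion B) : Bimod S S where
  obj := S.alg
  actS := S.frob.mul
  actT := S.frob.mul
  isBimodule :=
    { mul_actS := S.isFrobenius.mul_assoc
      one_actS := S.isFrobenius.one_mul
      actT_mul := by rw [S.isFrobenius.mul_assoc]; simp
      actT_one := S.isFrobenius.mul_one
      actS_actT := S.isFrobenius.mul_assoc }

variable {S T U V W : EqCompletion B}

/-- The endomorphism `π_T` of `M ≫ N`. -/
def idem (M : Bimod S T) (N : Bimod T U) : M.obj ≫ N.obj ⟶ M.obj ≫ N.obj :=
  relIdem T.frob M.actT N.actS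

theorem idem_balanced (M : Bimod S T) (N : Bimod T U) :
    M.actT ▷ N.obj ≫ idem M N = ((α_ M.obj T.alg N.obj).hom ≫ M.obj ◁ N.actS) ≫ idem M N :=
  relIdem_balanced T.isFrobenius _ _ M.isBimodule.actT_mul N.isBimodule.mul_actS

theorem idem_desc (M : Bimod S T) (N : Bimod T U) {Z : S.pt ⟶ U.pt} (f : M.obj ≫ N.obj ⟶ Z)
    (hf : M.actT ▷ N.obj ≫ f = ((α_ M.obj T.alg N.obj).hom ≫ M.obj ◁ N.actS) ≫ f) :
    idem M N ≫ f = f :=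
  relIdem_desc T.isSeparable _ _ N.isBimodule.mul_actS N.isBimodule.one_actS f hf

theorem idem_idem (M : Bimod S T) (N : Bimod T U) : idem M N ≫ idem M N = idem M N :=
  idem_desc M N _ (idem_balanced M N)

theorem idem_whiskerLeft (M : Bimod S T) {N N' : Bimod T U} (g : N ⟶ N') :
    idem M N ≫ M.obj ◁ g.hom = M.obj ◁ g.hom ≫ idem M N' :=
  relIdem_nat_right _ _ _ _ g.actS_comm

theorem idem_whiskerRight {M M' : Bimod S T} (f : M ⟶ M') (N : Bimod T U) :
    idem M N ≫ f.hom ▷ N.obj = f.hom ▷ N.obj ≫ idem M' N :=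
  relIdem_nat_left _ _ _ _ f.actT_comm

variable [hB : ∀ a b : B, IsIdempotentComplete (a ⟶ b)]

theorem exists_split (M : Bimod S T) (N : Bimod T U) :
    ∃ (Z : S.pt ⟶ U.pt) (i : Z ⟶ M.obj ≫ N.obj) (e : M.obj ≫ N.obj ⟶ Z),
      i ≫ e = 𝟙 Z ∧ e ≫ i = idem M N :=
  (hB S.pt U.pt).idempotents_split _ _ (idem_idem M N)

/-- The image of the idempotent `idem M N`. -/
noncomputable def tensObj (M : Bimod S T) (N : Bimod T U) : S.pt ⟶ U.pt := (exists_split M N).choose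

/-- The inclusion of the image of `idem M N`. -/
noncomputable def ι₀ (M : Bimod S T) (N : Bimod T U) : tensObj M N ⟶ M.obj ≫ N.obj :=
  (exists_split M N).choose_spec.choose

/-- The projection onto the image of `idem M N`. -/
noncomputable def π₀ (M : Bimod S T) (N : Bimod T U) : M.obj ≫ N.obj ⟶ tensObj M N :=
  (exists_split M N).choose_spec.choose_spec.choose

theorem ι₀_π₀ (M : Bimod S T) (N : Bimod T U) : ι₀ M N ≫ π₀ M N = 𝟙 _ :=
  (exists_split M N).choose_spec.choose_spec.choose_spec.1

theorem π₀_ι₀ (M : Bimod S T) (N : Bimod T U) : π₀ M N ≫ ι₀ M N = idem M N :=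
  (exists_split M N).choose_spec.choose_spec.choose_spec.2

theorem idem_π₀ (M : Bimod S T) (N : Bimod T U) : idem M N ≫ π₀ M N = π₀ M N := by
  rw [← π₀_ι₀, Category.assoc, ι₀_π₀, Category.comp_id]

instance (M : Bimod S T) (N : Bimod T U) : IsSplitEpi (π₀ M N) := ⟨⟨⟨ι₀ M N, ι₀_π₀ M N⟩⟩⟩

instance splitEpi_whiskerLeft {a b c : B} (Z : a ⟶ b) {X Y : b ⟶ c} (f : X ⟶ Y) [IsSplitEpi f] :
    IsSplitEpi (Z ◁ f) :=
  ⟨⟨⟨Z ◁ section_ f, by rw [← whiskerLeft_comp, IsSplitEpi.id, whiskerLeft_id]⟩⟩⟩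

instance splitEpi_whiskerRight {a b c : B} (Z : b ⟶ c) {X Y : a ⟶ b} (f : X ⟶ Y) [IsSplitEpi f] :
    IsSplitEpi (f ▷ Z) :=
  ⟨⟨⟨section_ f ▷ Z, by rw [← comp_whiskerRight, IsSplitEpi.id, id_whiskerRight]⟩⟩⟩

/-- The source action on the relative tensor product, induced by that on `M`. -/
noncomputable def tensActS (M : Bimod S T) (N : Bimod T U) : S.alg ≫ tensObj M N ⟶ tensObj M N :=
  S.alg ◁ ι₀ M N ≫ (α_ S.alg M.obj N.obj).inv ≫ M.actS ▷ N.obj ≫ π₀ M N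

/-- The target action on the relative tensor product, induced by that on `N`. -/
noncomputable def tensActT (M : Bimod S T) (N : Bimod T U) : tensObj M N ≫ U.alg ⟶ tensObj M N :=
  ι₀ M N ▷ U.alg ≫ (α_ M.obj N.obj U.alg).hom ≫ M.obj ◁ N.actT ≫ π₀ M N

theorem π₀_tensActS (M : Bimod S T) (N : Bimod T U) :
    S.alg ◁ π₀ M N ≫ tensActS M N = (α_ S.alg M.obj N.obj).inv ≫ M.actS ▷ N.obj ≫ π₀ M N := by
  have h := relIdem_nat_left (F := T.frob) ((α_ S.alg M.obj T.alg).hom ≫ S.alg ◁ M.actT) M.actT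
    N.actS M.actS (by rw [M.isBimodule.actS_actT, Category.assoc])
  rw [relIdem_comp_left] at h
  have h' : S.alg ◁ idem M N ≫ (α_ S.alg M.obj N.obj).inv ≫ M.actS ▷ N.obj =
      (α_ S.alg M.obj N.obj).inv ≫ M.actS ▷ N.obj ≫ idem M N := by
    rw [idem, ← h]; simp
  rw [tensActS, ← Category.assoc, ← whiskerLeft_comp, π₀_ι₀, ← Category.assoc, ← Category.assoc,
    Category.assoc (S.alg ◁ idem M N), h', Category.assoc, Category.assoc, idem_π₀]

theorem π₀_tensActT (M : Bimod S T) (N : Bimod T U) :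
    π₀ M N ▷ U.alg ≫ tensActT M N = (α_ M.obj N.obj U.alg).hom ≫ M.obj ◁ N.actT ≫ π₀ M N := by
  have h := relIdem_nat_right (F := T.frob) M.actT ((α_ T.alg N.obj U.alg).inv ≫ N.actS ▷ U.alg)
    N.actS N.actT (by rw [Category.assoc, N.isBimodule.actS_actT]; simp)
  rw [relIdem_comp_right] at h
  have h' : idem M N ▷ U.alg ≫ (α_ M.obj N.obj U.alg).hom ≫ M.obj ◁ N.actT =
      (α_ M.obj N.obj U.alg).hom ≫ M.obj ◁ N.actT ≫ idem M N := by
    rw [idem, ← h]; simp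
  rw [tensActT, ← Category.assoc, ← comp_whiskerRight, π₀_ι₀, ← Category.assoc, ← Category.assoc,
    Category.assoc (idem M N ▷ U.alg), h', Category.assoc, Category.assoc, idem_π₀]


theorem tens_isBimodule (M : Bimod S T) (N : Bimod T U) :
    IsBimodule S.frob U.frob (tensObj M N) (tensActS M N) (tensActT M N) where
  mul_actS := by
    have hM : (S.frob.mul ▷ M.obj ≫ M.actS) ▷ N.obj =
      ((α_ S.alg S.alg M.obj).hom ≫ S.alg ◁ M.actS ≫ M.actS) ▷ N.obj := by
        rw [M.isBimodule.mul_actS]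
    rw [← cancel_epi ((S.alg ≫ S.alg) ◁ π₀ M N)]
    calc
      _ = S.frob.mul ▷ (M.obj ≫ N.obj) ≫ S.alg ◁ π₀ M N ≫ tensActS M N := by
        rw [whisker_exchange_assoc]
      _ = (α_ _ _ _).inv ≫ (S.frob.mul ▷ M.obj ≫ M.actS) ▷ N.obj ≫ π₀ M N := by
        rw [π₀_tensActS]; simp
      _ = (α_ _ _ _).hom ≫ S.alg ◁ ((α_ _ _ _).inv ≫ M.actS ▷ N.obj) ≫ (α_ _ _ _).inv ≫
            M.actS ▷ N.obj ≫ π₀ M N := by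
        rw [hM]; simp
      _ = (α_ _ _ _).hom ≫ S.alg ◁ (S.alg ◁ π₀ M N ≫ tensActS M N) ≫ tensActS M N := by
        rw [← π₀_tensActS, ← whiskerLeft_comp_assoc, Category.assoc, ← π₀_tensActS]
      _ = _ := by simp
  one_actS := by
    have hM : (S.frob.one ▷ M.obj ≫ M.actS) ▷ N.obj = (λ_ M.obj).hom ▷ N.obj := by
        rw [M.isBimodule.one_actS]
    rw [← cancel_epi (𝟙 S.pt ◁ π₀ M N)]
    calc
      _ = S.frob.one ▷ (M.obj ≫ N.obj) ≫ S.alg ◁ π₀ M N ≫ tensActS M N := by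
        rw [whisker_exchange_assoc]
      _ = (α_ _ _ _).inv ≫ (S.frob.one ▷ M.obj ≫ M.actS) ▷ N.obj ≫ π₀ M N := by
        rw [π₀_tensActS]; simp
      _ = _ := by rw [hM]; simp
  actT_mul := by
    have hN : M.obj ◁ (N.obj ◁ U.frob.mul ≫ N.actT) =
      M.obj ◁ ((α_ N.obj U.alg U.alg).inv ≫ N.actT ▷ U.alg ≫ N.actT) := by
        rw [N.isBimodule.actT_mul]
    rw [← cancel_epi (π₀ M N ▷ (U.alg ≫ U.alg))]
    calc
      _ = (M.obj ≫ N.obj) ◁ U.frob.mul ≫ π₀ M N ▷ U.alg ≫ tensActT M N := by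
        rw [whisker_exchange_assoc]
      _ = (α_ _ _ _).hom ≫ M.obj ◁ (N.obj ◁ U.frob.mul ≫ N.actT) ≫ π₀ M N := by
        rw [π₀_tensActT]; simp
      _ = (α_ _ _ _).inv ≫ ((α_ _ _ _).hom ≫ M.obj ◁ N.actT) ▷ U.alg ≫ (α_ _ _ _).hom ≫
            M.obj ◁ N.actT ≫ π₀ M N := by
        rw [hN]; simp
      _ = (α_ _ _ _).inv ≫ (π₀ M N ▷ U.alg ≫ tensActT M N) ▷ U.alg ≫ tensActT M N := by
        rw [← π₀_tensActT, ← comp_whiskerRight_assoc, Category.assoc, ← π₀_tensActT]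
      _ = _ := by simp
  actT_one := by
    have hN : M.obj ◁ (N.obj ◁ U.frob.one ≫ N.actT) = M.obj ◁ (ρ_ N.obj).hom := by
        rw [N.isBimodule.actT_one]
    rw [← cancel_epi (π₀ M N ▷ 𝟙 U.pt)]
    calc
      _ = (M.obj ≫ N.obj) ◁ U.frob.one ≫ π₀ M N ▷ U.alg ≫ tensActT M N := by
        rw [whisker_exchange_assoc]
      _ = (α_ _ _ _).hom ≫ M.obj ◁ (N.obj ◁ U.frob.one ≫ N.actT) ≫ π₀ M N := by
        rw [π₀_tensActT]; simp
      _ = _ := by rw [hN]; simp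
  actS_actT := by
    rw [← cancel_epi ((S.alg ◁ π₀ M N) ▷ U.alg)]
    calc
      _ = (S.alg ◁ π₀ M N ≫ tensActS M N) ▷ U.alg ≫ tensActT M N := by simp
      _ = (α_ _ _ _).inv ▷ U.alg ≫ M.actS ▷ N.obj ▷ U.alg ≫ (α_ _ _ _).hom ≫
            M.obj ◁ N.actT ≫ π₀ M N := by
        rw [π₀_tensActS, ← π₀_tensActT]; simp
      _ = (α_ _ _ _).inv ▷ U.alg ≫ (α_ _ _ _).hom ≫
            (M.actS ▷ (N.obj ≫ U.alg) ≫ M.obj ◁ N.actT) ≫ π₀ M N := by simp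
      _ = (α_ _ _ _).hom ≫ S.alg ◁ ((α_ _ _ _).hom ≫ M.obj ◁ N.actT) ≫ (α_ _ _ _).inv ≫
            M.actS ▷ N.obj ≫ π₀ M N := by
        rw [← whisker_exchange]; simp
      _ = (α_ _ _ _).hom ≫ S.alg ◁ (π₀ M N ▷ U.alg ≫ tensActT M N) ≫ tensActS M N := by
        rw [← π₀_tensActS, ← whiskerLeft_comp_assoc, Category.assoc, ← π₀_tensActT]
      _ = _ := by simp

/-- The relative tensor product of bimodules, in diagrammatic order: for `M : (a, A) ⟶ (b, C)` and
`N : (b, C) ⟶ (c, D)` this is `N ⊗_C M`. See `isColimit` for the coequaliser property. -/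
noncomputable def tens (M : Bimod S T) (N : Bimod T U) : Bimod S U where
  obj := tensObj M N
  actS := tensActS M N
  actT := tensActT M N
  isBimodule := tens_isBimodule M N

/-- The splitting map of the relative tensor product. -/
noncomputable def ι (M : Bimod S T) (N : Bimod T U) : (tens M N).obj ⟶ M.obj ≫ N.obj := ι₀ M N

/-- The canonical projection to the relative tensor product. -/
noncomputable def π (M : Bimod S T) (N : Bimod T U) : M.obj ≫ N.obj ⟶ (tens M N).obj := π₀ M N

instance (M : Bimod S T) (N : Bimod T U) : IsSplitEpi (π M N) :=
  inferInstanceAs (IsSplitEpi (π₀ M N))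

theorem ι_π (M : Bimod S T) (N : Bimod T U) : ι M N ≫ π M N = 𝟙 (tens M N).obj := ι₀_π₀ M N

theorem π_ι (M : Bimod S T) (N : Bimod T U) : π M N ≫ ι M N = idem M N := π₀_ι₀ M N

theorem idem_π (M : Bimod S T) (N : Bimod T U) : idem M N ≫ π M N = π M N := idem_π₀ M N

theorem π_actS (M : Bimod S T) (N : Bimod T U) :
    S.alg ◁ π M N ≫ (tens M N).actS =
      (α_ S.alg M.obj N.obj).inv ≫ M.actS ▷ N.obj ≫ π M N := π₀_tensActS M N

theorem π_actT (M : Bimod S T) (N : Bimod T U) :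
    π M N ▷ U.alg ≫ (tens M N).actT =
      (α_ M.obj N.obj U.alg).hom ≫ M.obj ◁ N.actT ≫ π M N := π₀_tensActT M N

theorem π_balanced (M : Bimod S T) (N : Bimod T U) :
    M.actT ▷ N.obj ≫ π M N = ((α_ M.obj T.alg N.obj).hom ≫ M.obj ◁ N.actS) ≫ π M N := by
  rw [← idem_π, ← Category.assoc, idem_balanced, Category.assoc]

/-- The relative tensor product is the coequaliser of the two actions of the algebra in the middle. -/
noncomputable def isColimit (M : Bimod S T) (N : Bimod T U) :
    Limits.IsColimit (Limits.Cofork.ofπ (f := M.actT ▷ N.obj)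
      (g := (α_ M.obj T.alg N.obj).hom ≫ M.obj ◁ N.actS) (π M N) (π_balanced M N)) :=
  Limits.Cofork.IsColimit.mk _ (fun s => ι M N ≫ s.π)
    (fun s => by
      change π M N ≫ ι M N ≫ s.π = s.π
      rw [← Category.assoc, π_ι]
      exact idem_desc M N _ s.condition)
    (fun s m hm => by
      change π M N ≫ m = s.π at hm
      rw [← hm, ← Category.assoc, ι_π]
      exact (Category.id_comp m).symm)

theorem π_whiskerLeft (M : Bimod S T) {N N' : Bimod T U} (g : N ⟶ N') :
    π M N ≫ ι M N ≫ M.obj ◁ g.hom ≫ π M N' = M.obj ◁ g.hom ≫ π M N' := by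
  rw [← Category.assoc, π_ι, ← Category.assoc, idem_whiskerLeft, Category.assoc, idem_π]

theorem π_whiskerRight {M M' : Bimod S T} (f : M ⟶ M') (N : Bimod T U) :
    π M N ≫ ι M N ≫ f.hom ▷ N.obj ≫ π M' N = f.hom ▷ N.obj ≫ π M' N := by
  rw [← Category.assoc, π_ι, ← Category.assoc, idem_whiskerRight, Category.assoc, idem_π]

/-- The tensor product of a bimodule map with an identity, induced from `B`. -/
noncomputable def whiskerL (M : Bimod S T) {N N' : Bimod T U} (g : N ⟶ N') :
    tens M N ⟶ tens M N' where
  hom := ι M N ≫ M.obj ◁ g.hom ≫ π M N'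
  actS_comm := by
    rw [← cancel_epi (S.alg ◁ π M N), ← whiskerLeft_comp_assoc, π_whiskerLeft, ← Category.assoc,
      π_actS, whiskerLeft_comp]
    simp only [Category.assoc]
    rw [π_actS,
      π_whiskerLeft, ← whisker_exchange_assoc]
    simp
  actT_comm := by
    rw [← cancel_epi (π M N ▷ U.alg), ← comp_whiskerRight_assoc, π_whiskerLeft, ← Category.assoc,
      π_actT, comp_whiskerRight]
    simp only [Category.assoc]
    rw [π_actT,
      π_whiskerLeft, ← whiskerLeft_comp_assoc, g.actT_comm]
    simp

/-- The tensor product of a bimodule map with an identity, induced from `B`. -/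
noncomputable def whiskerR {M M' : Bimod S T} (f : M ⟶ M') (N : Bimod T U) :
    tens M N ⟶ tens M' N where
  hom := ι M N ≫ f.hom ▷ N.obj ≫ π M' N
  actS_comm := by
    rw [← cancel_epi (S.alg ◁ π M N), ← whiskerLeft_comp_assoc, π_whiskerRight, ← Category.assoc,
      π_actS, whiskerLeft_comp]
    simp only [Category.assoc]
    rw [π_actS,
      π_whiskerRight, ← comp_whiskerRight_assoc, f.actS_comm]
    simp
  actT_comm := by
    rw [← cancel_epi (π M N ▷ U.alg), ← comp_whiskerRight_assoc, π_whiskerRight, ← Category.assoc,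
      π_actT, comp_whiskerRight]
    simp only [Category.assoc]
    rw [π_actT,
      π_whiskerRight, whisker_exchange_assoc]
    simp

theorem π_whiskerL (M : Bimod S T) {N N' : Bimod T U} (g : N ⟶ N') :
    π M N ≫ (whiskerL M g).hom = M.obj ◁ g.hom ≫ π M N' := π_whiskerLeft M g

theorem π_whiskerR {M M' : Bimod S T} (f : M ⟶ M') (N : Bimod T U) :
    π M N ≫ (whiskerR f N).hom = f.hom ▷ N.obj ≫ π M' N := π_whiskerRight f N

/-- The 2-morphism induced by the associator of `B`; see `π_assoc`. -/
noncomputable def assocHom (M : Bimod S T) (N : Bimod T U) (P : Bimod U V) :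
    (tens (tens M N) P).obj ⟶ (tens M (tens N P)).obj :=
  ι (tens M N) P ≫ ι M N ▷ P.obj ≫ (α_ M.obj N.obj P.obj).hom ≫ M.obj ◁ π N P ≫ π M (tens N P)

/-- The 2-morphism induced by the inverse associator of `B`. -/
noncomputable def assocInv (M : Bimod S T) (N : Bimod T U) (P : Bimod U V) :
    (tens M (tens N P)).obj ⟶ (tens (tens M N) P).obj :=
  ι M (tens N P) ≫ M.obj ◁ ι N P ≫ (α_ M.obj N.obj P.obj).inv ≫ π M N ▷ P.obj ≫ π (tens M N) P

theorem whiskerLeft_π_idem (M : Bimod S T) (N : Bimod T U) (P : Bimod U V) :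
    M.obj ◁ π N P ≫ idem M (tens N P) =
      (α_ M.obj N.obj P.obj).inv ≫ idem M N ▷ P.obj ≫ (α_ M.obj N.obj P.obj).hom ≫
        M.obj ◁ π N P := by
  have h := relIdem_nat_right (F := T.frob) M.actT
    ((α_ T.alg N.obj P.obj).inv ≫ N.actS ▷ P.obj) (tens N P).actS (π N P)
    (by rw [Category.assoc]; exact (π_actS N P).symm)
  rw [relIdem_comp_right] at h
  simpa [idem] using h.symm

theorem π_whiskerRight_idem (M : Bimod S T) (N : Bimod T U) (P : Bimod U V) :
    π M N ▷ P.obj ≫ idem (tens M N) P =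
      (α_ M.obj N.obj P.obj).hom ≫ M.obj ◁ idem N P ≫ (α_ M.obj N.obj P.obj).inv ≫
        π M N ▷ P.obj := by
  have h := relIdem_nat_left (F := U.frob)
    ((α_ M.obj N.obj U.alg).hom ≫ M.obj ◁ N.actT) (tens M N).actT P.actS (π M N)
    (by rw [Category.assoc]; exact (π_actT M N).symm)
  rw [relIdem_comp_left] at h
  simpa [idem] using h.symm

theorem π_assocHom (M : Bimod S T) (N : Bimod T U) (P : Bimod U V) :
    π M N ▷ P.obj ≫ π (tens M N) P ≫ assocHom M N P =
      (α_ M.obj N.obj P.obj).hom ≫ M.obj ◁ π N P ≫ π M (tens N P) := by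
  calc
    _ = (π M N ▷ P.obj ≫ idem (tens M N) P) ≫ ι M N ▷ P.obj ≫ (α_ M.obj N.obj P.obj).hom ≫
          M.obj ◁ π N P ≫ π M (tens N P) := by
      rw [assocHom, ← π_ι]; simp
    _ = (α_ M.obj N.obj P.obj).hom ≫ M.obj ◁ idem N P ≫ (α_ M.obj N.obj P.obj).inv ≫
          idem M N ▷ P.obj ≫ (α_ M.obj N.obj P.obj).hom ≫ M.obj ◁ π N P ≫ π M (tens N P) := by
      rw [π_whiskerRight_idem, ← π_ι M N]; simp
    _ = (α_ M.obj N.obj P.obj).hom ≫ M.obj ◁ idem N P ≫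
          (M.obj ◁ π N P ≫ idem M (tens N P)) ≫ π M (tens N P) := by
      rw [whiskerLeft_π_idem]; simp
    _ = _ := by
      rw [Category.assoc, idem_π, ← whiskerLeft_comp_assoc, idem_π]

theorem π_assocInv (M : Bimod S T) (N : Bimod T U) (P : Bimod U V) :
    M.obj ◁ π N P ≫ π M (tens N P) ≫ assocInv M N P =
      (α_ M.obj N.obj P.obj).inv ≫ π M N ▷ P.obj ≫ π (tens M N) P := by
  calc
    _ = (M.obj ◁ π N P ≫ idem M (tens N P)) ≫ M.obj ◁ ι N P ≫ (α_ M.obj N.obj P.obj).inv ≫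
          π M N ▷ P.obj ≫ π (tens M N) P := by
      rw [assocInv, ← π_ι]; simp
    _ = (α_ M.obj N.obj P.obj).inv ≫ idem M N ▷ P.obj ≫ (α_ M.obj N.obj P.obj).hom ≫
          M.obj ◁ idem N P ≫ (α_ M.obj N.obj P.obj).inv ≫ π M N ▷ P.obj ≫ π (tens M N) P := by
      rw [whiskerLeft_π_idem, ← π_ι N P]; simp
    _ = (α_ M.obj N.obj P.obj).inv ≫ idem M N ▷ P.obj ≫
          (π M N ▷ P.obj ≫ idem (tens M N) P) ≫ π (tens M N) P := by
      rw [π_whiskerRight_idem]; simp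
    _ = _ := by
      rw [Category.assoc, idem_π, ← comp_whiskerRight_assoc, idem_π]


theorem assocHom_assocInv (M : Bimod S T) (N : Bimod T U) (P : Bimod U V) :
    assocHom M N P ≫ assocInv M N P = 𝟙 _ := by
  rw [← cancel_epi (π (tens M N) P), ← cancel_epi (π M N ▷ P.obj)]
  rw [reassoc_of% (π_assocHom M N P), π_assocInv]
  simp

theorem assocInv_assocHom (M : Bimod S T) (N : Bimod T U) (P : Bimod U V) :
    assocInv M N P ≫ assocHom M N P = 𝟙 _ := by
  rw [← cancel_epi (π M (tens N P)), ← cancel_epi (M.obj ◁ π N P)]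
  rw [reassoc_of% (π_assocInv M N P), π_assocHom]
  simp

/-- `assocHom` as a bimodule map. -/
noncomputable def assocMap (M : Bimod S T) (N : Bimod T U) (P : Bimod U V) :
    tens (tens M N) P ⟶ tens M (tens N P) where
  hom := assocHom M N P
  actS_comm := by
    rw [← cancel_epi (S.alg ◁ π (tens M N) P), ← cancel_epi (S.alg ◁ π M N ▷ P.obj)]
    calc
      _ = (S.alg ◁ π M N ▷ P.obj) ≫ (S.alg ◁ π (tens M N) P ≫ (tens (tens M N) P).actS) ≫
            assocHom M N P := by simp only [Category.assoc]
      _ = (α_ _ _ _).inv ≫ (S.alg ◁ π M N ≫ (tens M N).actS) ▷ P.obj ≫ π (tens M N) P ≫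
            assocHom M N P := by rw [π_actS]; simp
      _ = (α_ _ _ _).inv ≫ ((α_ _ _ _).inv ≫ M.actS ▷ N.obj) ▷ P.obj ≫ π M N ▷ P.obj ≫
            π (tens M N) P ≫ assocHom M N P := by rw [π_actS]; simp
      _ = S.alg ◁ (α_ _ _ _).hom ≫ (α_ _ _ _).inv ≫ (M.actS ▷ (N.obj ≫ P.obj) ≫
            M.obj ◁ π N P) ≫ π M (tens N P) := by rw [π_assocHom]; simp
      _ = S.alg ◁ (α_ _ _ _).hom ≫ S.alg ◁ M.obj ◁ π N P ≫ (α_ _ _ _).inv ≫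
            M.actS ▷ (tens N P).obj ≫ π M (tens N P) := by rw [← whisker_exchange]; simp
      _ = S.alg ◁ ((α_ _ _ _).hom ≫ M.obj ◁ π N P ≫ π M (tens N P)) ≫
            (tens M (tens N P)).actS := by rw [← π_actS]; simp
      _ = _ := by rw [← π_assocHom]; simp
  actT_comm := by
    rw [← cancel_epi (π (tens M N) P ▷ V.alg), ← cancel_epi (π M N ▷ P.obj ▷ V.alg)]
    calc
      _ = (π M N ▷ P.obj ▷ V.alg) ≫ (π (tens M N) P ▷ V.alg ≫ (tens (tens M N) P).actT) ≫
            assocHom M N P := by simp only [Category.assoc]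
      _ = (α_ _ _ _).hom ≫ (π M N ▷ (P.obj ≫ V.alg) ≫ (tens M N).obj ◁ P.actT) ≫
            π (tens M N) P ≫ assocHom M N P := by rw [π_actT]; simp
      _ = (α_ _ _ _).hom ≫ (M.obj ≫ N.obj) ◁ P.actT ≫ π M N ▷ P.obj ≫
            π (tens M N) P ≫ assocHom M N P := by rw [← whisker_exchange]; simp
      _ = (α_ _ _ _).hom ▷ V.alg ≫ (α_ _ _ _).hom ≫ M.obj ◁ ((α_ _ _ _).hom ≫ N.obj ◁ P.actT ≫
            π N P) ≫ π M (tens N P) := by rw [π_assocHom]; simp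
      _ = (α_ _ _ _).hom ▷ V.alg ≫ (M.obj ◁ π N P) ▷ V.alg ≫ (α_ _ _ _).hom ≫
            M.obj ◁ (tens N P).actT ≫ π M (tens N P) := by rw [← π_actT]; simp
      _ = ((α_ _ _ _).hom ≫ M.obj ◁ π N P ≫ π M (tens N P)) ▷ V.alg ≫
            (tens M (tens N P)).actT := by rw [← π_actT]; simp
      _ = _ := by rw [← π_assocHom]; simp

/-- The associator of `B_eq`, induced by the associator of `B`. -/
noncomputable def assoc (M : Bimod S T) (N : Bimod T U) (P : Bimod U V) :
    tens (tens M N) P ≅ tens M (tens N P) :=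
  isoMk (assocMap M N P) (assocInv M N P) (assocHom_assocInv M N P) (assocInv_assocHom M N P)

theorem π_assoc (M : Bimod S T) (N : Bimod T U) (P : Bimod U V) :
    π M N ▷ P.obj ≫ π (tens M N) P ≫ (assoc M N P).hom.hom =
      (α_ M.obj N.obj P.obj).hom ≫ M.obj ◁ π N P ≫ π M (tens N P) := π_assocHom M N P

/-- `ι` for the tensor product with a unit 1-morphism. -/
noncomputable def ιL (M : Bimod S T) : (tens (idHom S) M).obj ⟶ S.alg ≫ M.obj := ι (idHom S) M

/-- `π` for the tensor product with a unit 1-morphism. -/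
noncomputable def πL (M : Bimod S T) : S.alg ≫ M.obj ⟶ (tens (idHom S) M).obj := π (idHom S) M

/-- `ι` for the tensor product with a unit 1-morphism. -/
noncomputable def ιR (M : Bimod S T) : (tens M (idHom T)).obj ⟶ M.obj ≫ T.alg := ι M (idHom T)

/-- `π` for the tensor product with a unit 1-morphism. -/
noncomputable def πR (M : Bimod S T) : M.obj ≫ T.alg ⟶ (tens M (idHom T)).obj := π M (idHom T)

instance (M : Bimod S T) : IsSplitEpi (πL M) := inferInstanceAs (IsSplitEpi (π (idHom S) M))

instance (M : Bimod S T) : IsSplitEpi (πR M) := inferInstanceAs (IsSplitEpi (π M (idHom T)))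

theorem πL_balanced (M : Bimod S T) :
    S.frob.mul ▷ M.obj ≫ πL M = ((α_ S.alg S.alg M.obj).hom ≫ S.alg ◁ M.actS) ≫ πL M :=
  π_balanced (idHom S) M

theorem πR_balanced (M : Bimod S T) :
    M.actT ▷ T.alg ≫ πR M = ((α_ M.obj T.alg T.alg).hom ≫ M.obj ◁ T.frob.mul) ≫ πR M :=
  π_balanced M (idHom T)

theorem πL_ιL (M : Bimod S T) : πL M ≫ ιL M = idem (idHom S) M := π_ι (idHom S) M

theorem πR_ιR (M : Bimod S T) : πR M ≫ ιR M = idem M (idHom T) := π_ι M (idHom T)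

theorem πL_actS (M : Bimod S T) :
    S.alg ◁ πL M ≫ (tens (idHom S) M).actS =
      (α_ S.alg S.alg M.obj).inv ≫ S.frob.mul ▷ M.obj ≫ πL M := π_actS (idHom S) M

theorem πL_actT (M : Bimod S T) :
    πL M ▷ T.alg ≫ (tens (idHom S) M).actT =
      (α_ S.alg M.obj T.alg).hom ≫ S.alg ◁ M.actT ≫ πL M := π_actT (idHom S) M

theorem πR_actS (M : Bimod S T) :
    S.alg ◁ πR M ≫ (tens M (idHom T)).actS =
      (α_ S.alg M.obj T.alg).inv ≫ M.actS ▷ T.alg ≫ πR M := π_actS M (idHom T)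

theorem πR_actT (M : Bimod S T) :
    πR M ▷ T.alg ≫ (tens M (idHom T)).actT =
      (α_ M.obj T.alg T.alg).hom ≫ M.obj ◁ T.frob.mul ≫ πR M := π_actT M (idHom T)

theorem π_leftHom (M : Bimod S T) : πL M ≫ ιL M ≫ M.actS = M.actS := by
  have h : idem (idHom S) M ≫ M.actS = M.actS := idem_desc (idHom S) M _
    (M.isBimodule.mul_actS.trans (Category.assoc _ _ _).symm)
  rw [← Category.assoc, πL_ιL]
  exact h

theorem π_rightHom (M : Bimod S T) : πR M ≫ ιR M ≫ M.actT = M.actT := by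
  have h : idem M (idHom T) ≫ M.actT = M.actT := idem_desc M (idHom T) _ (by
    have e : M.actT ▷ T.alg ≫ M.actT =
        ((α_ M.obj T.alg T.alg).hom ≫ M.obj ◁ T.frob.mul) ≫ M.actT := by
      rw [Category.assoc, M.isBimodule.actT_mul]; simp
    exact e)
  rw [← Category.assoc, πR_ιR]
  exact h

/-- The bimodule map induced by the action on the source side. -/
noncomputable def leftMap (M : Bimod S T) : tens (idHom S) M ⟶ M where
  hom := ιL M ≫ M.actS
  actS_comm := by
    rw [← cancel_epi (S.alg ◁ πL M), ← whiskerLeft_comp_assoc, π_leftHom, ← Category.assoc, πL_actS]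
    simp only [Category.assoc]
    rw [π_leftHom, M.isBimodule.mul_actS]; simp
  actT_comm := by
    rw [← cancel_epi (πL M ▷ T.alg), ← comp_whiskerRight_assoc, π_leftHom, ← Category.assoc,
      πL_actT]
    simp only [Category.assoc]
    rw [π_leftHom]
    exact M.isBimodule.actS_actT.symm

/-- The bimodule map induced by the action on the target side. -/
noncomputable def rightMap (M : Bimod S T) : tens M (idHom T) ⟶ M where
  hom := ιR M ≫ M.actT
  actS_comm := by
    rw [← cancel_epi (S.alg ◁ πR M), ← whiskerLeft_comp_assoc, π_rightHom, ← Category.assoc,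
      πR_actS]
    simp only [Category.assoc]
    rw [π_rightHom, M.isBimodule.actS_actT]; simp
  actT_comm := by
    rw [← cancel_epi (πR M ▷ T.alg), ← comp_whiskerRight_assoc, π_rightHom, ← Category.assoc,
      πR_actT]
    simp only [Category.assoc]
    rw [π_rightHom, M.isBimodule.actT_mul]; simp

theorem leftMap_inv (M : Bimod S T) :
    (ιL M ≫ M.actS) ≫ (λ_ M.obj).inv ≫ S.frob.one ▷ M.obj ≫ πL M = 𝟙 _ := by
  have h1 := S.isFrobenius.one_mul
  rw [← cancel_epi (πL M)]
  calc
    _ = (πL M ≫ ιL M ≫ M.actS) ≫ (λ_ M.obj).inv ≫ S.frob.one ▷ M.obj ≫ πL M := by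
      simp only [Category.assoc]
    _ = (λ_ (S.alg ≫ M.obj)).inv ≫ (𝟙 S.pt ◁ M.actS ≫ S.frob.one ▷ M.obj) ≫ πL M := by
      rw [π_leftHom]; simp
    _ = (λ_ (S.alg ≫ M.obj)).inv ≫ S.frob.one ▷ (S.alg ≫ M.obj) ≫
          (α_ S.alg S.alg M.obj).inv ≫ ((α_ S.alg S.alg M.obj).hom ≫ S.alg ◁ M.actS) ≫ πL M := by
      rw [whisker_exchange]; simp
    _ = (λ_ (S.alg ≫ M.obj)).inv ≫ (α_ _ _ _).inv ≫ (S.frob.one ▷ S.alg ≫ S.frob.mul) ▷ M.obj ≫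
          πL M := by
      rw [← πL_balanced]; simp
    _ = _ := by rw [h1]; simp

theorem rightMap_inv (M : Bimod S T) :
    (ιR M ≫ M.actT) ≫ (ρ_ M.obj).inv ≫ M.obj ◁ T.frob.one ≫ πR M = 𝟙 _ := by
  have h1 := T.isFrobenius.mul_one
  rw [← cancel_epi (πR M)]
  calc
    _ = (πR M ≫ ιR M ≫ M.actT) ≫ (ρ_ M.obj).inv ≫ M.obj ◁ T.frob.one ≫ πR M := by
      simp only [Category.assoc]
    _ = (ρ_ (M.obj ≫ T.alg)).inv ≫ (M.actT ▷ 𝟙 T.pt ≫ M.obj ◁ T.frob.one) ≫ πR M := by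
      rw [π_rightHom]; simp
    _ = (ρ_ (M.obj ≫ T.alg)).inv ≫ (M.obj ≫ T.alg) ◁ T.frob.one ≫ M.actT ▷ T.alg ≫ πR M := by
      rw [← whisker_exchange]; simp
    _ = (ρ_ (M.obj ≫ T.alg)).inv ≫ (α_ _ _ _).hom ≫ M.obj ◁ (T.alg ◁ T.frob.one ≫ T.frob.mul) ≫
          πR M := by
      rw [πR_balanced]; simp
    _ = _ := by rw [h1]; simp

/-- The unit action of `B_eq` on the source side, given by the module action; see `πL_leftU`. -/
noncomputable def leftU (M : Bimod S T) : tens (idHom S) M ≅ M :=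
  isoMk (leftMap M) ((λ_ M.obj).inv ≫ S.frob.one ▷ M.obj ≫ πL M) (leftMap_inv M)
    (by
      simp only [leftMap, Category.assoc]
      rw [π_leftHom, M.isBimodule.one_actS]; simp)

/-- The unit action of `B_eq` on the target side, given by the module action; see `πR_rightU`. -/
noncomputable def rightU (M : Bimod S T) : tens M (idHom T) ≅ M :=
  isoMk (rightMap M) ((ρ_ M.obj).inv ≫ M.obj ◁ T.frob.one ≫ πR M) (rightMap_inv M)
    (by
      simp only [rightMap, Category.assoc]
      rw [π_rightHom, M.isBimodule.actT_one]; simp)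

theorem πL_leftU (M : Bimod S T) : πL M ≫ (leftU M).hom.hom = M.actS := π_leftHom M

theorem πR_rightU (M : Bimod S T) : πR M ≫ (rightU M).hom.hom = M.actT := π_rightHom M

theorem whiskerL_id (M : Bimod S T) (N : Bimod T U) : whiskerL M (𝟙 N) = 𝟙 (tens M N) := by
  apply hom₂_ext
  rw [← cancel_epi (π M N), π_whiskerL]
  simp

theorem whiskerR_id (M : Bimod S T) (N : Bimod T U) : whiskerR (𝟙 M) N = 𝟙 (tens M N) := by
  apply hom₂_ext
  rw [← cancel_epi (π M N), π_whiskerR]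
  simp

theorem whiskerL_comp (M : Bimod S T) {N N' N'' : Bimod T U} (f : N ⟶ N') (g : N' ⟶ N'') :
    whiskerL M (f ≫ g) = whiskerL M f ≫ whiskerL M g := by
  apply hom₂_ext
  rw [← cancel_epi (π M N), π_whiskerL, comp_hom, comp_hom, reassoc_of% (π_whiskerL M f), π_whiskerL]
  simp

theorem whiskerR_comp {M M' M'' : Bimod S T} (f : M ⟶ M') (g : M' ⟶ M'') (N : Bimod T U) :
    whiskerR (f ≫ g) N = whiskerR f N ≫ whiskerR g N := by
  apply hom₂_ext
  rw [← cancel_epi (π M N), π_whiskerR, comp_hom, comp_hom, reassoc_of% (π_whiskerR f N), π_whiskerR]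
  simp

theorem idHom_whiskerL {M N : Bimod S T} (g : M ⟶ N) :
    whiskerL (idHom S) g ≫ (leftU N).hom = (leftU M).hom ≫ g := by
  apply hom₂_ext
  have h : πL M ≫ (whiskerL (idHom S) g).hom = S.alg ◁ g.hom ≫ πL N := π_whiskerL (idHom S) g
  rw [← cancel_epi (πL M), comp_hom, comp_hom, reassoc_of% h, πL_leftU,
    reassoc_of% (πL_leftU M), g.actS_comm]

theorem whiskerR_idHom {M N : Bimod S T} (g : M ⟶ N) :
    whiskerR g (idHom T) ≫ (rightU N).hom = (rightU M).hom ≫ g := by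
  apply hom₂_ext
  have h : πR M ≫ (whiskerR g (idHom T)).hom = g.hom ▷ T.alg ≫ πR N := π_whiskerR g (idHom T)
  rw [← cancel_epi (πR M), comp_hom, comp_hom, reassoc_of% h, πR_rightU,
    reassoc_of% (πR_rightU M), g.actT_comm]

theorem tens_whiskerL (M : Bimod S T) (N : Bimod T U) {P P' : Bimod U V} (g : P ⟶ P') :
    whiskerL (tens M N) g ≫ (assoc M N P').hom =
      (assoc M N P).hom ≫ whiskerL M (whiskerL N g) := by
  apply hom₂_ext
  rw [← cancel_epi (π (tens M N) P), ← cancel_epi (π M N ▷ P.obj), comp_hom, comp_hom,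
    reassoc_of% (π_whiskerL (tens M N) g), reassoc_of% (π_assoc M N P), π_whiskerL,
    ← whiskerLeft_comp_assoc, π_whiskerL, ← whisker_exchange_assoc, π_assoc]
  simp

theorem whiskerR_tens {M M' : Bimod S T} (f : M ⟶ M') (N : Bimod T U) (P : Bimod U V) :
    whiskerR (whiskerR f N) P ≫ (assoc M' N P).hom =
      (assoc M N P).hom ≫ whiskerR f (tens N P) := by
  apply hom₂_ext
  rw [← cancel_epi (π (tens M N) P), ← cancel_epi (π M N ▷ P.obj), comp_hom, comp_hom,
    reassoc_of% (π_whiskerR (whiskerR f N) P), reassoc_of% (π_assoc M N P), π_whiskerR,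
    ← comp_whiskerRight_assoc, π_whiskerR, whisker_exchange_assoc, comp_whiskerRight,
    Category.assoc, π_assoc]
  simp

theorem whiskerR_whiskerL (M : Bimod S T) {N N' : Bimod T U} (g : N ⟶ N') (P : Bimod U V) :
    whiskerR (whiskerL M g) P ≫ (assoc M N' P).hom =
      (assoc M N P).hom ≫ whiskerL M (whiskerR g P) := by
  apply hom₂_ext
  rw [← cancel_epi (π (tens M N) P), ← cancel_epi (π M N ▷ P.obj), comp_hom, comp_hom,
    reassoc_of% (π_whiskerR (whiskerL M g) P), reassoc_of% (π_assoc M N P), π_whiskerL,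
    ← comp_whiskerRight_assoc, π_whiskerL, ← whiskerLeft_comp_assoc, π_whiskerR,
    comp_whiskerRight, Category.assoc, π_assoc]
  simp

theorem whiskerLR_exchange {M M' : Bimod S T} {N N' : Bimod T U} (f : M ⟶ M') (g : N ⟶ N') :
    whiskerL M g ≫ whiskerR f N' = whiskerR f N ≫ whiskerL M' g := by
  apply hom₂_ext
  rw [← cancel_epi (π M N), comp_hom, comp_hom, reassoc_of% (π_whiskerL M g),
    reassoc_of% (π_whiskerR f N), π_whiskerR, π_whiskerL, whisker_exchange_assoc]

theorem tens_pentagon (M : Bimod S T) (N : Bimod T U) (P : Bimod U V) (Q : Bimod V W) :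
    whiskerR (assoc M N P).hom Q ≫ (assoc M (tens N P) Q).hom ≫ whiskerL M (assoc N P Q).hom =
      (assoc (tens M N) P Q).hom ≫ (assoc M N (tens P Q)).hom := by
  apply hom₂_ext
  rw [← cancel_epi (π (tens (tens M N) P) Q), ← cancel_epi (π (tens M N) P ▷ Q.obj),
    ← cancel_epi (π M N ▷ P.obj ▷ Q.obj)]
  simp only [comp_hom]
  calc
    _ = (π M N ▷ P.obj ≫ π (tens M N) P ≫ (assoc M N P).hom.hom) ▷ Q.obj ≫
          π (tens M (tens N P)) Q ≫ (assoc M (tens N P) Q).hom.hom ≫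
          (whiskerL M (assoc N P Q).hom).hom := by
      rw [reassoc_of% (π_whiskerR (assoc M N P).hom Q)]; simp
    _ = (α_ _ _ _).hom ▷ Q.obj ≫ (M.obj ◁ π N P) ▷ Q.obj ≫ (α_ _ _ _).hom ≫
          M.obj ◁ (π (tens N P) Q ≫ (assoc N P Q).hom.hom) ≫
          π M (tens N (tens P Q)) := by
      rw [π_assoc]
      simp only [comp_whiskerRight, Category.assoc]
      rw [reassoc_of% (π_assoc M (tens N P) Q), π_whiskerL, whiskerLeft_comp, Category.assoc]
    _ = (α_ _ _ _).hom ▷ Q.obj ≫ (α_ _ _ _).hom ≫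
          M.obj ◁ (π N P ▷ Q.obj ≫ π (tens N P) Q ≫ (assoc N P Q).hom.hom) ≫
          π M (tens N (tens P Q)) := by simp
    _ = (α_ _ _ _).hom ≫ (M.obj ≫ N.obj) ◁ π P Q ≫ (α_ _ _ _).hom ≫
          M.obj ◁ π N (tens P Q) ≫ π M (tens N (tens P Q)) := by
      rw [π_assoc]; simp
    _ = (α_ _ _ _).hom ≫ ((M.obj ≫ N.obj) ◁ π P Q ≫ π M N ▷ (tens P Q).obj) ≫
          π (tens M N) (tens P Q) ≫ (assoc M N (tens P Q)).hom.hom := by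
      rw [Category.assoc, π_assoc]
    _ = π M N ▷ P.obj ▷ Q.obj ≫ (α_ _ _ _).hom ≫ (tens M N).obj ◁ π P Q ≫
          π (tens M N) (tens P Q) ≫ (assoc M N (tens P Q)).hom.hom := by
      rw [whisker_exchange]; simp
    _ = _ := by rw [reassoc_of% (π_assoc (tens M N) P Q)]

theorem tens_triangle (M : Bimod S T) (N : Bimod T U) :
    (assoc M (idHom T) N).hom ≫ whiskerL M (leftU N).hom = whiskerR (rightU M).hom N := by
  apply hom₂_ext
  have h : πR M ▷ N.obj ≫ π (tens M (idHom T)) N ≫ (assoc M (idHom T) N).hom.hom =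
      (α_ M.obj T.alg N.obj).hom ≫ M.obj ◁ πL N ≫ π M (tens (idHom T) N) :=
    π_assoc M (idHom T) N
  rw [← cancel_epi (π (tens M (idHom T)) N), ← cancel_epi (πR M ▷ N.obj), comp_hom,
    reassoc_of% h, π_whiskerL, π_whiskerR, ← whiskerLeft_comp_assoc, πL_leftU,
    ← comp_whiskerRight_assoc, πR_rightU, π_balanced, Category.assoc]

/-- The equivariant completion `B_eq`. -/
noncomputable instance bicategory : Bicategory (EqCompletion B) where
  Hom S T := Bimod S T
  id S := idHom S
  comp M N := tens M N
  homCategory S T := bimodCategory S T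
  whiskerLeft M _ _ g := whiskerL M g
  whiskerRight f N := whiskerR f N
  associator M N P := assoc M N P
  leftUnitor M := leftU M
  rightUnitor M := rightU M
  whiskerLeft_id M N := whiskerL_id M N
  whiskerLeft_comp M _ _ _ f g := whiskerL_comp M f g
  id_whiskerLeft g := by
    rw [← Category.assoc, Iso.eq_comp_inv]; exact idHom_whiskerL g
  comp_whiskerLeft M N _ _ g := by
    rw [← Category.assoc, Iso.eq_comp_inv]; exact tens_whiskerL M N g
  id_whiskerRight M N := whiskerR_id M N
  comp_whiskerRight f g N := whiskerR_comp f g N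
  whiskerRight_id g := by
    rw [← Category.assoc, Iso.eq_comp_inv]; exact whiskerR_idHom g
  whiskerRight_comp f N P := by
    rw [Iso.eq_inv_comp]; exact (whiskerR_tens f N P).symm
  whisker_assoc M _ _ g P := by
    rw [← Category.assoc, Iso.eq_comp_inv]; exact whiskerR_whiskerL M g P
  whisker_exchange f g := whiskerLR_exchange f g
  pentagon M N P Q := tens_pentagon M N P Q
  triangle M N := tens_triangle M N

variable (B) in
/-- The object `(b, I_b)` of `B_eq`. -/
def ofObj (b : B) : EqCompletion B where
  pt := b
  alg := 𝟙 b
  frob := FrobData.unit b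
  isFrobenius := FrobData.unit_isFrobenius b
  isSeparable := FrobData.unit_isSeparable b

end EqCompletion

end Algebras

section Pivotal

/-- A pivotal bicategory: every 1-morphism `X : a ⟶ b` comes with a 1-morphism `X† : b ⟶ a` and with
chosen adjunctions `X† ⊣ X` (unit `coev_X`, counit `ev_X`) and `X ⊣ X†` (unit `coev~_X`, counit
`ev~_X`), such that the left and the right adjoint agree on 2-morphisms (`dual_map`), and the two
canonical 2-morphisms `(Y ⊗ X)† ⟶ X† ⊗ Y†` built from the left and from the right adjunctions
agree (`dual_comp`). -/
class PivotalBicategory (B : Type u) [Bicategory.{w, v} B] where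
  /-- The two-sided adjoint `X†`. -/
  dual {a b : B} (X : a ⟶ b) : b ⟶ a
  /-- The adjunction `X† ⊣ X`, given by `coev_X` and `ev_X`. -/
  leftAdj {a b : B} (X : a ⟶ b) : Bicategory.Adjunction (dual X) X
  /-- The adjunction `X ⊣ X†`, given by `coev~_X` and `ev~_X`. -/
  rightAdj {a b : B} (X : a ⟶ b) : Bicategory.Adjunction X (dual X)
  dual_map {a b : B} {X Z : a ⟶ b} (φ : Z ⟶ X) :
    (𝟙 (dual X) ⊗≫ dual X ◁ (rightAdj Z).unit ⊗≫ dual X ◁ φ ▷ dual Z ⊗≫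
      (rightAdj X).counit ▷ dual Z ⊗≫ 𝟙 (dual Z)) =
    (𝟙 (dual X) ⊗≫ (leftAdj Z).unit ▷ dual X ⊗≫ dual Z ◁ φ ▷ dual X ⊗≫
      dual Z ◁ (leftAdj X).counit ⊗≫ 𝟙 (dual Z))
  dual_comp {a b c : B} (X : a ⟶ b) (Y : b ⟶ c) :
    (𝟙 (dual (X ≫ Y)) ⊗≫ dual (X ≫ Y) ◁ (rightAdj X).unit ⊗≫
      dual (X ≫ Y) ◁ X ◁ (rightAdj Y).unit ▷ dual X ⊗≫
      (rightAdj (X ≫ Y)).counit ▷ (dual Y ≫ dual X) ⊗≫ 𝟙 (dual Y ≫ dual X)) =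
    (𝟙 (dual (X ≫ Y)) ⊗≫ (leftAdj Y).unit ▷ dual (X ≫ Y) ⊗≫
      dual Y ◁ (leftAdj X).unit ▷ Y ▷ dual (X ≫ Y) ⊗≫
      (dual Y ≫ dual X) ◁ (leftAdj (X ≫ Y)).counit ⊗≫ 𝟙 (dual Y ≫ dual X))

open PivotalBicategory

variable {B : Type u} [Bicategory.{w, v} B] [PivotalBicategory B]

/-- A (Frobenius) algebra `A` in `B(a, a)` is symmetric if
`((ε ∘ μ) ⊗ 1) ∘ (1 ⊗ coev_A) = (1 ⊗ (ε ∘ μ)) ∘ (coev~_A ⊗ 1)` as 2-morphisms `A ⟶ A†`. -/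
def FrobData.IsSymmetric {a : B} {A : a ⟶ a} (F : FrobData A) : Prop :=
  (𝟙 A ⊗≫ (leftAdj A).unit ▷ A ⊗≫ dual A ◁ (F.mul ≫ F.counit) ⊗≫ 𝟙 (dual A)) =
    (𝟙 A ⊗≫ A ◁ (rightAdj A).unit ⊗≫ (F.mul ≫ F.counit) ▷ dual A ⊗≫ 𝟙 (dual A))

/-- The right quantum dimension `dim_r(X) = ev~_X ∘ coev_X`, an endomorphism of `I_b`. -/
def dimR {a b : B} (X : a ⟶ b) : 𝟙 b ⟶ 𝟙 b :=
  (leftAdj X).unit ≫ (rightAdj X).counit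

/-- The algebra and coalgebra structure on `X† ⊗ X`.  The multiplication is
`1 ⊗ ev~_X ⊗ 1`, the unit is `coev~_X`; the comultiplication is `1 ⊗ (coev_X ∘ dim_r(X)⁻¹) ⊗ 1` and
the counit is `ev_X ∘ (1 ⊗ dim_r(X) ⊗ 1)`. -/
noncomputable def dualFrob {a b : B} (X : a ⟶ b) [IsIso (dimR X)] : FrobData (X ≫ dual X) where
  mul := 𝟙 _ ⊗≫ X ◁ (rightAdj X).counit ▷ dual X ⊗≫ 𝟙 _
  one := (rightAdj X).unit
  comul := 𝟙 _ ⊗≫ X ◁ (inv (dimR X) ≫ (leftAdj X).unit) ▷ dual X ⊗≫ 𝟙 _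
  counit := 𝟙 _ ⊗≫ X ◁ dimR X ▷ dual X ⊗≫ (leftAdj X).counit

/-- The right action `X ⊗ (X† ⊗ X) ⟶ X` given by `ev~_X`. -/
def evalAct {a b : B} (X : a ⟶ b) : (X ≫ dual X) ≫ X ⟶ X :=
  (α_ X (dual X) X).hom ≫ X ◁ (rightAdj X).counit ≫ (ρ_ X).hom

/-- The left action `(X† ⊗ X) ⊗ X† ⟶ X†` given by `ev~_X`. -/
def evalActDual {a b : B} (X : a ⟶ b) : dual X ≫ (X ≫ dual X) ⟶ dual X :=
  (α_ (dual X) X (dual X)).inv ≫ (rightAdj X).counit ▷ dual X ≫ (λ_ (dual X)).hom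

variable (B) in
/-- The orbifold completion `B_orb`: the full subbicategory of `B_eq` on the pairs `(a, A)` with `A`
a symmetric separable Frobenius algebra. -/
abbrev OrbCompletion [∀ a b : B, IsIdempotentComplete (a ⟶ b)] : Type (max u v w) :=
  InducedBicategory (EqCompletion B)
    (Subtype.val : {S : EqCompletion B // S.frob.IsSymmetric} → EqCompletion B)

end Pivotal

end Orbifold

open Orbifold PivotalBicategory

/-! A pair of adjunctions `X ⊣ Y` and `Y ⊣ X` makes `X ≫ Y` a Frobenius algebra by interchange and
the triangle identities alone (`ambiFrob_isFrobenius`). Rescaling `X† ⊣ X` by `dim_r(X)` keeps it an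
adjunction and turns `ev~_X ∘ coev_X` into the identity, which is separability.

Tensor products over an algebra are images of the idempotents `relIdem`. Over `I_b` this idempotent
is the identity, so one composite of `X` and `X†` is `A` itself. Over `A` it is `coev_X ∘ dim_r(X)⁻¹
∘ ev~_X` (`relIdem_ambiFrob`), which splits through `I_b`, so the other composite is the unit
1-morphism of `(b, I_b)`. Two such invertible 2-morphisms can always be corrected to an adjoint
equivalence, and `B_orb` is full in `B_eq`.

Symmetry is the point where pivotality enters. Transposing `ε ∘ μ` along composite left or right
adjunctions yields `dim_r(X)` followed by a comparison `X ⟶ X††` (`dualFrob_transposeL`,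
`dualFrob_transposeR`), so the two comparisons must agree (`toDoubleR_eq_toDoubleL`). This follows
from `nameR_eq_nameL`: a 2-morphism `Z ⟶ 𝟙` has the same mate `𝟙 ⟶ Z†` for both adjunctions. Here
`dual_map` gives equality up to the two identifications of `𝟙†` with `𝟙`, and `dual_comp` for `𝟙 ≫
𝟙` shows that these coincide. -/

namespace Orbifold

/-! ### Frobenius algebras and bimodules from two-sided adjunctions -/

section Ambidextrous

variable {B : Type u} [Bicategory.{w, v} B] {a b : B} {X : a ⟶ b} {Y : b ⟶ a}

/-- A pair of adjunctions `X ⊣ Y` and `Y ⊣ X` makes `X ≫ Y` an algebra and a coalgebra. -/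
def ambiFrob (adj : Bicategory.Adjunction X Y) (adj' : Bicategory.Adjunction Y X) :
    FrobData (X ≫ Y) where
  mul := 𝟙 _ ⊗≫ X ◁ adj.counit ▷ Y ⊗≫ 𝟙 _
  one := adj.unit
  comul := 𝟙 _ ⊗≫ X ◁ adj'.unit ▷ Y ⊗≫ 𝟙 _
  counit := adj'.counit

/-- Between the outer `X` and `Y`, (co)associativity is the interchange of two copies of
`adj.counit` (of `adj'.unit`), and the Frobenius laws are the interchange of one with the other.
Unit laws are the triangles of `adj`, counit laws those of `adj'`. The remaining steps are
coherence. -/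
theorem ambiFrob_isFrobenius (adj : Bicategory.Adjunction X Y)
    (adj' : Bicategory.Adjunction Y X) : (ambiFrob adj adj').IsFrobenius where
  mul_assoc := by
    dsimp only [ambiFrob]
    calc
      _ = 𝟙 _ ⊗≫ X ◁ (adj.counit ▷ (Y ≫ X) ≫ 𝟙 b ◁ adj.counit) ▷ Y ⊗≫ 𝟙 _ := by bicategory
      _ = 𝟙 _ ⊗≫ X ◁ ((Y ≫ X) ◁ adj.counit ≫ adj.counit ▷ 𝟙 b) ▷ Y ⊗≫ 𝟙 _ := by
        rw [whisker_exchange]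
      _ = _ := by bicategory
  one_mul := by
    dsimp only [ambiFrob]
    calc
      _ = 𝟙 _ ⊗≫ leftZigzag adj.unit adj.counit ▷ Y ⊗≫ 𝟙 _ := by
        dsimp only [leftZigzag]; bicategory
      _ = _ := by rw [adj.left_triangle]; bicategory
  mul_one := by
    dsimp only [ambiFrob]
    calc
      _ = 𝟙 _ ⊗≫ X ◁ rightZigzag adj.unit adj.counit ⊗≫ 𝟙 _ := by
        dsimp only [rightZigzag]; bicategory
      _ = _ := by rw [adj.right_triangle]; bicategory
  comul_assoc := by
    dsimp only [ambiFrob]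
    calc
      _ = 𝟙 _ ⊗≫ X ◁ (𝟙 b ◁ adj'.unit ≫ adj'.unit ▷ (Y ≫ X)) ▷ Y ⊗≫ 𝟙 _ := by bicategory
      _ = 𝟙 _ ⊗≫ X ◁ (adj'.unit ▷ 𝟙 b ≫ (Y ≫ X) ◁ adj'.unit) ▷ Y ⊗≫ 𝟙 _ := by
        rw [whisker_exchange]
      _ = _ := by bicategory
  counit_comul := by
    dsimp only [ambiFrob]
    calc
      _ = 𝟙 _ ⊗≫ rightZigzag adj'.unit adj'.counit ▷ Y ⊗≫ 𝟙 _ := by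
        dsimp only [rightZigzag]; bicategory
      _ = _ := by rw [adj'.right_triangle]; bicategory
  comul_counit := by
    dsimp only [ambiFrob]
    calc
      _ = 𝟙 _ ⊗≫ X ◁ leftZigzag adj'.unit adj'.counit ⊗≫ 𝟙 _ := by
        dsimp only [leftZigzag]; bicategory
      _ = _ := by rw [adj'.left_triangle]; bicategory
  frobenius_left := by
    dsimp only [ambiFrob]
    calc
      _ = 𝟙 _ ⊗≫ X ◁ ((Y ≫ X) ◁ adj'.unit ≫ adj.counit ▷ (Y ≫ X)) ▷ Y ⊗≫ 𝟙 _ := by bicategory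
      _ = 𝟙 _ ⊗≫ X ◁ (adj.counit ▷ 𝟙 b ≫ 𝟙 b ◁ adj'.unit) ▷ Y ⊗≫ 𝟙 _ := by
        rw [whisker_exchange]
      _ = _ := by bicategory
  frobenius_right := by
    dsimp only [ambiFrob]
    calc
      _ = 𝟙 _ ⊗≫ X ◁ (adj'.unit ▷ (Y ≫ X) ≫ (Y ≫ X) ◁ adj.counit) ▷ Y ⊗≫ 𝟙 _ := by bicategory
      _ = 𝟙 _ ⊗≫ X ◁ (𝟙 b ◁ adj.counit ≫ adj'.unit ▷ 𝟙 b) ▷ Y ⊗≫ 𝟙 _ := by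
        rw [whisker_exchange]
      _ = _ := by bicategory

theorem ambiFrob_isSeparable (adj : Bicategory.Adjunction X Y) (adj' : Bicategory.Adjunction Y X)
    (h : adj'.unit ≫ adj.counit = 𝟙 (𝟙 b)) : (ambiFrob adj adj').IsSeparable := by
  dsimp only [FrobData.IsSeparable, ambiFrob]
  calc
    _ = 𝟙 _ ⊗≫ X ◁ (adj'.unit ≫ adj.counit) ▷ Y ⊗≫ 𝟙 _ := by bicategory
    _ = _ := by rw [h]; bicategory

/-- Rescaling an adjunction `Y ⊣ X` by an automorphism of the unit 1-morphism. -/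
def twistAdj (adj' : Bicategory.Adjunction Y X) (d e : 𝟙 b ⟶ 𝟙 b) (h : e ≫ d = 𝟙 (𝟙 b)) :
    Bicategory.Adjunction Y X where
  unit := e ≫ adj'.unit
  counit := 𝟙 _ ⊗≫ X ◁ d ▷ Y ⊗≫ adj'.counit
  left_triangle := by
    calc
      _ = 𝟙 _ ⊗≫ e ▷ Y ⊗≫ (adj'.unit ▷ (𝟙 b) ≫ (Y ≫ X) ◁ d) ▷ Y ⊗≫ Y ◁ adj'.counit ⊗≫ 𝟙 _ := by
        dsimp only [leftZigzag]; bicategory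
      -- The interchange law slides `d` past the unit of `adj'` so that it meets `e`; the old
      -- triangle is left over.
      _ = 𝟙 _ ⊗≫ e ▷ Y ⊗≫ (𝟙 b ◁ d ≫ adj'.unit ▷ (𝟙 b)) ▷ Y ⊗≫ Y ◁ adj'.counit ⊗≫ 𝟙 _ := by
        rw [whisker_exchange]
      _ = 𝟙 _ ⊗≫ (e ≫ d) ▷ Y ⊗≫ leftZigzag adj'.unit adj'.counit ⊗≫ 𝟙 _ := by
        dsimp only [leftZigzag]; bicategory
      _ = _ := by rw [h, adj'.left_triangle]; bicategory
  right_triangle := by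
    calc
      _ = 𝟙 _ ⊗≫ X ◁ e ⊗≫ X ◁ ((𝟙 b) ◁ adj'.unit ≫ d ▷ (Y ≫ X)) ⊗≫ adj'.counit ▷ X ⊗≫ 𝟙 _ := by
        dsimp only [rightZigzag]; bicategory
      _ = 𝟙 _ ⊗≫ X ◁ e ⊗≫ X ◁ (d ▷ 𝟙 b ≫ 𝟙 b ◁ adj'.unit) ⊗≫ adj'.counit ▷ X ⊗≫ 𝟙 _ := by
        rw [whisker_exchange]
      _ = 𝟙 _ ⊗≫ X ◁ (e ≫ d) ⊗≫ rightZigzag adj'.unit adj'.counit ⊗≫ 𝟙 _ := by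
        dsimp only [rightZigzag]; bicategory
      _ = _ := by rw [h, adj'.right_triangle]; bicategory

/-- These are the associativity and unit laws of `X ≫ Y` with the outer factor `Y` removed; for `Y`
as a module, the outer `X` is removed instead. -/
theorem isBimodule_left (adj : Bicategory.Adjunction X Y) (adj' : Bicategory.Adjunction Y X) :
    IsBimodule (ambiFrob adj adj') (FrobData.unit b) X
      ((α_ X Y X).hom ≫ X ◁ adj.counit ≫ (ρ_ X).hom) (ρ_ X).hom where
  mul_actS := by
    dsimp only [ambiFrob]
    calc
      _ = 𝟙 _ ⊗≫ X ◁ (adj.counit ▷ (Y ≫ X) ≫ 𝟙 b ◁ adj.counit) ⊗≫ 𝟙 _ := by bicategory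
      _ = 𝟙 _ ⊗≫ X ◁ ((Y ≫ X) ◁ adj.counit ≫ adj.counit ▷ 𝟙 b) ⊗≫ 𝟙 _ := by
        rw [whisker_exchange]
      _ = _ := by bicategory
  one_actS := by
    dsimp only [ambiFrob]
    calc
      _ = 𝟙 _ ⊗≫ leftZigzag adj.unit adj.counit ⊗≫ 𝟙 _ := by
        dsimp only [leftZigzag]; bicategory
      _ = _ := by rw [adj.left_triangle]; bicategory
  actT_mul := by dsimp only [FrobData.unit]; bicategory
  actT_one := by dsimp only [FrobData.unit]; bicategory
  actS_actT := by bicategory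

theorem isBimodule_right (adj : Bicategory.Adjunction X Y) (adj' : Bicategory.Adjunction Y X) :
    IsBimodule (FrobData.unit b) (ambiFrob adj adj') Y (λ_ Y).hom
      ((α_ Y X Y).inv ≫ adj.counit ▷ Y ≫ (λ_ Y).hom) where
  mul_actS := by dsimp only [FrobData.unit]; bicategory
  one_actS := by dsimp only [FrobData.unit]; bicategory
  actT_mul := by
    dsimp only [ambiFrob]
    calc
      _ = 𝟙 _ ⊗≫ ((Y ≫ X) ◁ adj.counit ≫ adj.counit ▷ 𝟙 b) ▷ Y ⊗≫ 𝟙 _ := by bicategory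
      _ = 𝟙 _ ⊗≫ (adj.counit ▷ (Y ≫ X) ≫ 𝟙 b ◁ adj.counit) ▷ Y ⊗≫ 𝟙 _ := by
        rw [whisker_exchange]
      _ = _ := by bicategory
  actT_one := by
    dsimp only [ambiFrob]
    calc
      _ = 𝟙 _ ⊗≫ rightZigzag adj.unit adj.counit ⊗≫ 𝟙 _ := by
        dsimp only [rightZigzag]; bicategory
      _ = _ := by rw [adj.right_triangle]; bicategory
  actS_actT := by bicategory

/-- Tensoring over a unit 1-morphism therefore imposes no relation: the relative product is the
composite in `B`. -/
theorem relIdem_unit {c : B} (Z : b ⟶ c) :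
    relIdem (FrobData.unit b) (ρ_ X).hom (λ_ Z).hom = 𝟙 (X ≫ Z) := by
  dsimp only [relIdem, FrobData.unit]; bicategory

/-- One of the two counits coming from the actions cancels the inserted `adj.unit` by a triangle of
`adj`; what is left is the other counit and `adj'.unit`, which interchange. If `adj'.unit ≫
adj.counit` is the identity, the result visibly splits through `𝟙 b`. -/
theorem relIdem_ambiFrob (adj : Bicategory.Adjunction X Y) (adj' : Bicategory.Adjunction Y X) :
    relIdem (ambiFrob adj adj') ((α_ Y X Y).inv ≫ adj.counit ▷ Y ≫ (λ_ Y).hom)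
      ((α_ X Y X).hom ≫ X ◁ adj.counit ≫ (ρ_ X).hom) = adj.counit ≫ adj'.unit := by
  dsimp only [relIdem, ambiFrob]
  calc
    _ = 𝟙 _ ⊗≫ Y ◁ adj.unit ▷ X ⊗≫ ((Y ≫ X) ◁ adj'.unit ≫ adj.counit ▷ (Y ≫ X)) ▷ (Y ≫ X) ⊗≫
          (Y ≫ X) ◁ adj.counit ⊗≫ 𝟙 _ := by bicategory
    _ = 𝟙 _ ⊗≫ Y ◁ adj.unit ▷ X ⊗≫ (adj.counit ▷ 𝟙 b ≫ 𝟙 b ◁ adj'.unit) ▷ (Y ≫ X) ⊗≫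
          (Y ≫ X) ◁ adj.counit ⊗≫ 𝟙 _ := by rw [whisker_exchange]
    _ = 𝟙 _ ⊗≫ rightZigzag adj.unit adj.counit ▷ X ⊗≫ (adj'.unit ▷ (Y ≫ X) ≫
          (Y ≫ X) ◁ adj.counit) ⊗≫ 𝟙 _ := by dsimp only [rightZigzag]; bicategory
    _ = 𝟙 _ ⊗≫ (𝟙 b ◁ adj.counit ≫ adj'.unit ▷ 𝟙 b) ⊗≫ 𝟙 _ := by
      rw [adj.right_triangle, ← whisker_exchange]; bicategory
    _ = _ := by bicategory

end Ambidextrous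

/-! ### Transposes along adjunctions and comparison of adjoints -/

section Transpose

variable {B : Type u} [Bicategory.{w, v} B] {a b : B}

/-- The transpose `W ⟶ g` of a pairing `W ≫ f ⟶ 𝟙` along an adjunction `f ⊣ g`. -/
def transposeR {f : a ⟶ b} {g : b ⟶ a} (adj : Bicategory.Adjunction f g) {W : b ⟶ a}
    (κ : W ≫ f ⟶ 𝟙 b) : W ⟶ g :=
  𝟙 _ ⊗≫ W ◁ adj.unit ⊗≫ κ ▷ g ⊗≫ 𝟙 _

/-- The transpose `W ⟶ g` of a pairing `f ≫ W ⟶ 𝟙` along an adjunction `g ⊣ f`. -/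
def transposeL {f : a ⟶ b} {g : b ⟶ a} (adj : Bicategory.Adjunction g f) {W : b ⟶ a}
    (κ : f ≫ W ⟶ 𝟙 a) : W ⟶ g :=
  𝟙 _ ⊗≫ adj.unit ▷ W ⊗≫ g ◁ κ ⊗≫ 𝟙 _

/-- The second factor is the canonical comparison of two right adjoints of `f`. Interchange brings
the unit and the counit of `adj` together and a triangle removes them. This allows the chosen
adjunction of a composite to be traded for the composite adjunction. -/
theorem transposeR_trans {f : a ⟶ b} {g g' : b ⟶ a} (adj : Bicategory.Adjunction f g)
    (adj' : Bicategory.Adjunction f g') {W : b ⟶ a} (κ : W ≫ f ⟶ 𝟙 b) :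
    transposeR adj κ ≫ transposeR adj' adj.counit = transposeR adj' κ := by
  dsimp only [transposeR]
  calc
    _ = 𝟙 _ ⊗≫ W ◁ adj.unit ⊗≫ (κ ▷ (g ≫ 𝟙 a) ≫ 𝟙 b ◁ (g ◁ adj'.unit)) ⊗≫
          adj.counit ▷ g' ⊗≫ 𝟙 _ := by bicategory
    _ = 𝟙 _ ⊗≫ W ◁ (adj.unit ▷ 𝟙 a ≫ (f ≫ g) ◁ adj'.unit) ⊗≫
          (κ ▷ (g ≫ f) ≫ 𝟙 b ◁ adj.counit) ▷ g' ⊗≫ 𝟙 _ := by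
      rw [← whisker_exchange]; bicategory
    _ = 𝟙 _ ⊗≫ W ◁ adj'.unit ⊗≫ W ◁ leftZigzag adj.unit adj.counit ▷ g' ⊗≫ κ ▷ g' ⊗≫ 𝟙 _ := by
      rw [← whisker_exchange, ← whisker_exchange]; dsimp only [leftZigzag]; bicategory
    _ = _ := by rw [adj.left_triangle]; bicategory

theorem transposeL_trans {f : a ⟶ b} {g g' : b ⟶ a} (adj : Bicategory.Adjunction g f)
    (adj' : Bicategory.Adjunction g' f) {W : b ⟶ a} (κ : f ≫ W ⟶ 𝟙 a) :
    transposeL adj κ ≫ transposeL adj' adj.counit = transposeL adj' κ := by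
  dsimp only [transposeL]
  calc
    _ = 𝟙 _ ⊗≫ adj.unit ▷ W ⊗≫ (𝟙 b ◁ (g ◁ κ) ≫ adj'.unit ▷ (g ≫ 𝟙 a)) ⊗≫
          g' ◁ adj.counit ⊗≫ 𝟙 _ := by bicategory
    _ = 𝟙 _ ⊗≫ (𝟙 b ◁ adj.unit ≫ adj'.unit ▷ (g ≫ f)) ▷ W ⊗≫
          g' ◁ ((f ≫ g) ◁ κ ≫ adj.counit ▷ 𝟙 a) ⊗≫ 𝟙 _ := by
      rw [whisker_exchange]; bicategory
    _ = 𝟙 _ ⊗≫ adj'.unit ▷ W ⊗≫ g' ◁ rightZigzag adj.unit adj.counit ▷ W ⊗≫ g' ◁ κ ⊗≫ 𝟙 _ := by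
      rw [whisker_exchange, whisker_exchange]; dsimp only [rightZigzag]; bicategory
    _ = _ := by rw [adj.right_triangle]; bicategory

theorem transposeR_counit {f : a ⟶ b} {g : b ⟶ a} (adj : Bicategory.Adjunction f g) :
    transposeR adj adj.counit = 𝟙 g := by
  calc
    _ = 𝟙 _ ⊗≫ rightZigzag adj.unit adj.counit ⊗≫ 𝟙 _ := by
      dsimp only [rightZigzag, transposeR]; bicategory
    _ = _ := by rw [adj.right_triangle]; bicategory

/-- Uniqueness of right adjoints: the comparison in the opposite direction is the inverse. -/
instance {f : a ⟶ b} {g g' : b ⟶ a} (adj : Bicategory.Adjunction f g)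
    (adj' : Bicategory.Adjunction f g') : IsIso (transposeR adj' adj.counit) :=
  ⟨transposeR adj adj'.counit, by rw [transposeR_trans, transposeR_counit],
    by rw [transposeR_trans, transposeR_counit]⟩

/-- The 2-morphism `𝟙 ⟶ g` corresponding to `φ : f ⟶ 𝟙` under an adjunction `f ⊣ g`. -/
def nameR {f g : a ⟶ a} (adj : Bicategory.Adjunction f g) (φ : f ⟶ 𝟙 a) : 𝟙 a ⟶ g :=
  adj.unit ≫ φ ▷ g ≫ (λ_ g).hom

/-- The 2-morphism `𝟙 ⟶ g` corresponding to `φ : f ⟶ 𝟙` under an adjunction `g ⊣ f`. -/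
def nameL {f g : a ⟶ a} (adj : Bicategory.Adjunction g f) (φ : f ⟶ 𝟙 a) : 𝟙 a ⟶ g :=
  adj.unit ≫ g ◁ φ ≫ (ρ_ g).hom

theorem nameR_eq_transposeR {f g : a ⟶ a} (adj : Bicategory.Adjunction f g) (φ : f ⟶ 𝟙 a) :
    nameR adj φ = transposeR adj ((λ_ f).hom ≫ φ) := by
  dsimp only [nameR, transposeR]; bicategory

theorem nameL_eq_transposeL {f g : a ⟶ a} (adj : Bicategory.Adjunction g f) (φ : f ⟶ 𝟙 a) :
    nameL adj φ = transposeL adj ((ρ_ f).hom ≫ φ) := by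
  dsimp only [nameL, transposeL]; bicategory

theorem nameR_trans {f g g' : a ⟶ a} (adj : Bicategory.Adjunction f g)
    (adj' : Bicategory.Adjunction f g') (φ : f ⟶ 𝟙 a) :
    nameR adj φ ≫ transposeR adj' adj.counit = nameR adj' φ := by
  rw [nameR_eq_transposeR, transposeR_trans, nameR_eq_transposeR]

theorem nameL_trans {f g g' : a ⟶ a} (adj : Bicategory.Adjunction g f)
    (adj' : Bicategory.Adjunction g' f) (φ : f ⟶ 𝟙 a) :
    nameL adj φ ≫ transposeL adj' adj.counit = nameL adj' φ := by
  rw [nameL_eq_transposeL, transposeL_trans, nameL_eq_transposeL]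

/-- The name of `𝟙 ≫ 𝟙 ⟶ 𝟙` is the tensor square of the name of the identity. This quadratic
behaviour is what fixes the normalisation in `nameR_id_eq_nameL_id`. -/
theorem nameR_comp_unit {g : a ⟶ a} (adj : Bicategory.Adjunction (𝟙 a) g) :
    nameR (adj.comp adj) (λ_ (𝟙 a)).hom =
      nameR adj (𝟙 _) ≫ (ρ_ g).inv ≫ g ◁ nameR adj (𝟙 _) := by
  calc
    _ = 𝟙 _ ⊗≫ (𝟙 a ◁ nameR adj (𝟙 _) ≫ nameR adj (𝟙 _) ▷ g) ⊗≫ 𝟙 _ := by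
      dsimp only [nameR, Bicategory.Adjunction.comp, Bicategory.Adjunction.compUnit]
      bicategory
    _ = _ := by
      rw [whisker_exchange]; bicategory

theorem nameL_comp_unit {g : a ⟶ a} (adj : Bicategory.Adjunction g (𝟙 a)) :
    nameL (adj.comp adj) (λ_ (𝟙 a)).hom =
      nameL adj (𝟙 _) ≫ (ρ_ g).inv ≫ g ◁ nameL adj (𝟙 _) := by
  dsimp only [nameL, Bicategory.Adjunction.comp, Bicategory.Adjunction.compUnit]
  bicategory

end Transpose

/-! ### Mates of 2-morphisms into the unit in a pivotal bicategory -/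

section Pivotal

variable {B : Type u} [Bicategory.{w, v} B] [PivotalBicategory B] {a b c : B}

/-- This is `dual_comp` in the language of transposes: a single comparison `(X ≫ Y)† ⟶ Y† ≫ X†`
serves both kinds of adjunction. -/
theorem transpose_comp_counit (X : a ⟶ b) (Y : b ⟶ c) :
    transposeR ((rightAdj X).comp (rightAdj Y)) (rightAdj (X ≫ Y)).counit =
      transposeL ((leftAdj Y).comp (leftAdj X)) (leftAdj (X ≫ Y)).counit := by
  calc
    _ = _ := by
      dsimp only [transposeR, Bicategory.Adjunction.comp, Bicategory.Adjunction.compUnit]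
      bicategory
    _ = _ := dual_comp X Y
    _ = _ := by
      dsimp only [transposeL, Bicategory.Adjunction.comp, Bicategory.Adjunction.compUnit]
      bicategory

/-- This is `dual_map` for `φ`: since the target of `φ` is `𝟙`, interchange factors each of the two
induced maps `𝟙† ⟶ Z†` through `𝟙`, as a counit followed by a name. -/
theorem counitR_nameR {Z : a ⟶ a} (φ : Z ⟶ 𝟙 a) :
    (ρ_ (dual (𝟙 a))).inv ≫ (rightAdj (𝟙 a)).counit ≫ nameR (rightAdj Z) φ =
      (λ_ (dual (𝟙 a))).inv ≫ (leftAdj (𝟙 a)).counit ≫ nameL (leftAdj Z) φ := by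
  calc
    _ = 𝟙 _ ⊗≫ ((rightAdj (𝟙 a)).counit ▷ 𝟙 a ≫ 𝟙 a ◁ (rightAdj Z).unit) ⊗≫
          φ ▷ dual Z ⊗≫ 𝟙 _ := by
      dsimp only [nameR]; bicategory
    _ = 𝟙 _ ⊗≫ dual (𝟙 a) ◁ (rightAdj Z).unit ⊗≫ ((rightAdj (𝟙 a)).counit ▷ Z ≫ 𝟙 a ◁ φ) ▷ dual Z
          ⊗≫ 𝟙 _ := by
      rw [← whisker_exchange]; bicategory
    _ = 𝟙 _ ⊗≫ dual (𝟙 a) ◁ (rightAdj Z).unit ⊗≫ dual (𝟙 a) ◁ φ ▷ dual Z ⊗≫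
      (rightAdj (𝟙 a)).counit ▷ dual Z ⊗≫ 𝟙 (dual Z) := by
      rw [← whisker_exchange]; bicategory
    _ = 𝟙 _ ⊗≫ (leftAdj Z).unit ▷ dual (𝟙 a) ⊗≫ dual Z ◁ φ ▷ dual (𝟙 a) ⊗≫
      dual Z ◁ (leftAdj (𝟙 a)).counit ⊗≫ 𝟙 (dual Z) := dual_map φ
    _ = 𝟙 _ ⊗≫ (leftAdj Z).unit ▷ dual (𝟙 a) ⊗≫ dual Z ◁ (φ ▷ (𝟙 a ≫ dual (𝟙 a)) ≫
      𝟙 a ◁ (leftAdj (𝟙 a)).counit) ⊗≫ 𝟙 (dual Z) := by bicategory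
    _ = 𝟙 _ ⊗≫ ((leftAdj Z).unit ▷ (𝟙 a ≫ dual (𝟙 a)) ≫ (dual Z ≫ Z) ◁ (leftAdj (𝟙 a)).counit) ⊗≫
          dual Z ◁ φ ⊗≫ 𝟙 (dual Z) := by
      rw [← whisker_exchange]; bicategory
    _ = _ := by
      rw [← whisker_exchange]; dsimp only [nameL]; bicategory

/-- This and the next three lemmas show that for each of the two adjunctions the counit `𝟙† ⟶ 𝟙` and
the name of the identity are mutually inverse, by one triangle each. -/
theorem counitR_nameR_id (a : B) :
    (ρ_ (dual (𝟙 a))).inv ≫ (rightAdj (𝟙 a)).counit ≫ nameR (rightAdj (𝟙 a)) (𝟙 _) = 𝟙 _ := by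
  calc
    _ = 𝟙 _ ⊗≫ ((rightAdj (𝟙 a)).counit ▷ 𝟙 a ≫ 𝟙 a ◁ (rightAdj (𝟙 a)).unit) ⊗≫ 𝟙 _ := by
      dsimp only [nameR]; bicategory
    _ = 𝟙 _ ⊗≫ rightZigzag (rightAdj (𝟙 a)).unit (rightAdj (𝟙 a)).counit ⊗≫ 𝟙 _ := by
      rw [← whisker_exchange]; dsimp only [rightZigzag]; bicategory
    _ = _ := by rw [(rightAdj (𝟙 a)).right_triangle]; bicategory

theorem counitL_nameL_id (a : B) :
    (λ_ (dual (𝟙 a))).inv ≫ (leftAdj (𝟙 a)).counit ≫ nameL (leftAdj (𝟙 a)) (𝟙 _) = 𝟙 _ := by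
  calc
    _ = 𝟙 _ ⊗≫ (𝟙 a ◁ (leftAdj (𝟙 a)).counit ≫ (leftAdj (𝟙 a)).unit ▷ 𝟙 a) ⊗≫ 𝟙 _ := by
      dsimp only [nameL]; bicategory
    _ = 𝟙 _ ⊗≫ leftZigzag (leftAdj (𝟙 a)).unit (leftAdj (𝟙 a)).counit ⊗≫ 𝟙 _ := by
      rw [whisker_exchange]; dsimp only [leftZigzag]; bicategory
    _ = _ := by rw [(leftAdj (𝟙 a)).left_triangle]; bicategory

theorem nameR_id_counitR (a : B) :
    nameR (rightAdj (𝟙 a)) (𝟙 _) ≫ (ρ_ (dual (𝟙 a))).inv ≫ (rightAdj (𝟙 a)).counit = 𝟙 _ := by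
  calc
    _ = 𝟙 _ ⊗≫ leftZigzag (rightAdj (𝟙 a)).unit (rightAdj (𝟙 a)).counit ⊗≫ 𝟙 _ := by
      dsimp only [leftZigzag, nameR]; bicategory
    _ = _ := by rw [(rightAdj (𝟙 a)).left_triangle]; bicategory

theorem nameL_id_counitL (a : B) :
    nameL (leftAdj (𝟙 a)) (𝟙 _) ≫ (λ_ (dual (𝟙 a))).inv ≫ (leftAdj (𝟙 a)).counit = 𝟙 _ := by
  calc
    _ = 𝟙 _ ⊗≫ rightZigzag (leftAdj (𝟙 a)).unit (leftAdj (𝟙 a)).counit ⊗≫ 𝟙 _ := by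
      dsimp only [rightZigzag, nameL]; bicategory
    _ = _ := by rw [(leftAdj (𝟙 a)).right_triangle]; bicategory

/-- In `counitR_nameR` for `𝟙 ≫ 𝟙 ⟶ 𝟙`, the names become squares once `(𝟙 ≫ 𝟙)†` is compared with
`𝟙† ≫ 𝟙†`. Each counit cancels one factor of its square, which leaves the two names themselves,
whiskered by `𝟙†`. -/
theorem nameR_id_eq_nameL_id (a : B) :
    nameR (rightAdj (𝟙 a)) (𝟙 _) = nameL (leftAdj (𝟙 a)) (𝟙 _) := by
  have h := counitR_nameR (λ_ (𝟙 a)).hom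
  have h2 := congrArg (· ≫ transposeR ((rightAdj (𝟙 a)).comp (rightAdj (𝟙 a)))
    (rightAdj (𝟙 a ≫ 𝟙 a)).counit) h
  simp only [Category.assoc, nameR_trans] at h2
  rw [transpose_comp_counit, nameL_trans, nameR_comp_unit, nameL_comp_unit,
    reassoc_of% (counitR_nameR_id a), reassoc_of% (counitL_nameL_id a)] at h2
  rw [cancel_epi] at h2
  -- Whiskering by `𝟙†` is injective because `𝟙†` is isomorphic to `𝟙`; this formula recovers `n`
  -- from `𝟙† ◁ n`.
  have key (n : 𝟙 a ⟶ dual (𝟙 a)) : nameR (rightAdj (𝟙 a)) (𝟙 _) ≫ (ρ_ _).inv ≫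
      dual (𝟙 a) ◁ n ≫ ((ρ_ (dual (𝟙 a))).inv ≫ (rightAdj (𝟙 a)).counit) ▷ dual (𝟙 a) ≫
      (λ_ _).hom = n := by
    rw [whisker_exchange_assoc]
    calc
      _ = 𝟙 _ ⊗≫ (nameR (rightAdj (𝟙 a)) (𝟙 _) ≫ (ρ_ (dual (𝟙 a))).inv ≫
        (rightAdj (𝟙 a)).counit) ⊗≫ n := by bicategory
      _ = _ := by rw [nameR_id_counitR]; bicategory
  rw [← key (nameR _ _), h2, key]

/-- The left and the right adjunction of a 1-morphism `Z : a ⟶ a` turn a 2-morphism `Z ⟶ 𝟙` into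
the same 2-morphism `𝟙 ⟶ Z†`. -/
theorem nameR_eq_nameL {Z : a ⟶ a} (φ : Z ⟶ 𝟙 a) :
    nameR (rightAdj Z) φ = nameL (leftAdj Z) φ := by
  -- The names of the identity agree and invert both counits, so precomposing with them strips the
  -- counits from `counitR_nameR`.
  have h := congrArg (nameR (rightAdj (𝟙 a)) (𝟙 _) ≫ ·) (counitR_nameR φ)
  rw [reassoc_of% (nameR_id_counitR a), nameR_id_eq_nameL_id,
    reassoc_of% (nameL_id_counitL a)] at h
  exact h

theorem unit_isSymmetric (a : B) : (FrobData.unit a).IsSymmetric := by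
  dsimp only [FrobData.IsSymmetric, FrobData.unit]
  calc
    _ = nameL (leftAdj (𝟙 a)) (𝟙 _) := by dsimp only [nameL]; bicategory
    _ = nameR (rightAdj (𝟙 a)) (𝟙 _) := (nameR_eq_nameL _).symm
    _ = _ := by dsimp only [nameR]; bicategory

/-! ### The two comparisons of a 1-morphism with its double dual -/

/-- The 2-morphism `X ⟶ X††` comparing the two right adjoints of `X†`. -/
def toDoubleR (X : a ⟶ b) : X ⟶ dual (dual X) := transposeR (rightAdj (dual X)) (leftAdj X).counit

/-- The 2-morphism `X ⟶ X††` comparing the two left adjoints of `X†`. -/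
def toDoubleL (X : a ⟶ b) : X ⟶ dual (dual X) := transposeL (leftAdj (dual X)) (rightAdj X).counit

/-- Both sides are mates of `ev_X : X ≫ X† ⟶ 𝟙`, for the composite right and left adjunctions; on
the left-adjoint side `coev_X` and `ev_X` cancel. -/
theorem unit_toDoubleR (X : a ⟶ b) :
    (rightAdj X).unit ≫ toDoubleR X ▷ dual X = (leftAdj (dual X)).unit := by
  have h := congrArg (· ≫ transposeR ((rightAdj X).comp (rightAdj (dual X)))
    (rightAdj (X ≫ dual X)).counit) (nameR_eq_nameL (leftAdj X).counit)
  rw [nameR_trans, transpose_comp_counit, nameL_trans] at h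
  calc
    _ = nameR ((rightAdj X).comp (rightAdj (dual X))) (leftAdj X).counit := by
      dsimp only [nameR, toDoubleR, transposeR, Bicategory.Adjunction.comp,
        Bicategory.Adjunction.compUnit]
      bicategory
    _ = 𝟙 _ ⊗≫ (leftAdj (dual X)).unit ⊗≫ dual (dual X) ◁
          leftZigzag (leftAdj X).unit (leftAdj X).counit ⊗≫ 𝟙 _ := by
      rw [h]
      dsimp only [nameL, leftZigzag, Bicategory.Adjunction.comp, Bicategory.Adjunction.compUnit]
      bicategory
    _ = _ := by rw [(leftAdj X).left_triangle]; bicategory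

/-- Substituting `unit_toDoubleR` for the unit in `toDoubleL` leaves `toDoubleR` and a zigzag of `X
⊣ X†`. -/
theorem toDoubleR_eq_toDoubleL (X : a ⟶ b) : toDoubleR X = toDoubleL X := by
  symm
  calc
    _ = 𝟙 _ ⊗≫ (rightAdj X).unit ▷ X ⊗≫ (toDoubleR X ▷ (dual X ≫ X) ≫
          dual (dual X) ◁ (rightAdj X).counit) ⊗≫ 𝟙 _ := by
      dsimp only [toDoubleL, transposeL]
      rw [← unit_toDoubleR]; bicategory
    _ = 𝟙 _ ⊗≫ leftZigzag (rightAdj X).unit (rightAdj X).counit ⊗≫ toDoubleR X := by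
      rw [← whisker_exchange]; dsimp only [leftZigzag]; bicategory
    _ = _ := by rw [(rightAdj X).left_triangle]; bicategory

/-! ### Symmetry, Frobenius property and separability of `X† ⊗ X` -/

/-- The adjunction `X† ⊣ X` rescaled by the right quantum dimension. -/
noncomputable def rescaledAdj (X : a ⟶ b) [IsIso (dimR X)] : Bicategory.Adjunction (dual X) X :=
  twistAdj (leftAdj X) (dimR X) (inv (dimR X)) (IsIso.inv_hom_id _)

theorem dualFrob_eq_ambiFrob (X : a ⟶ b) [IsIso (dimR X)] :
    dualFrob X = ambiFrob (rightAdj X) (rescaledAdj X) := rfl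

theorem FrobData.isSymmetric_iff {A : a ⟶ a} (F : FrobData A) : F.IsSymmetric ↔
    transposeL (leftAdj A) (F.mul ≫ F.counit) = transposeR (rightAdj A) (F.mul ≫ F.counit) := by
  have hL : (𝟙 A ⊗≫ (leftAdj A).unit ▷ A ⊗≫ dual A ◁ (F.mul ≫ F.counit) ⊗≫ 𝟙 (dual A)) =
      transposeL (leftAdj A) (F.mul ≫ F.counit) := rfl
  have hR : (𝟙 A ⊗≫ A ◁ (rightAdj A).unit ⊗≫ (F.mul ≫ F.counit) ▷ dual A ⊗≫ 𝟙 (dual A)) =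
      transposeR (rightAdj A) (F.mul ≫ F.counit) := rfl
  rw [FrobData.IsSymmetric, hL, hR]

/-- Here `coev_X` cancels `ev_X`, while the unit of `X†† ⊣ X†` and `ev~_X` form `toDoubleL`. In the
version for right adjunctions `coev~_X` cancels `ev~_X`, and `ev_X` contributes to `toDoubleR`. -/
theorem dualFrob_transposeL (X : a ⟶ b) [IsIso (dimR X)] :
    transposeL ((leftAdj (dual X)).comp (leftAdj X)) ((dualFrob X).mul ≫ (dualFrob X).counit) =
      𝟙 _ ⊗≫ X ◁ dimR X ▷ dual X ⊗≫ toDoubleL X ▷ dual X := by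
  calc
    _ = 𝟙 _ ⊗≫ (leftAdj (dual X)).unit ▷ (X ≫ dual X) ⊗≫ dual (dual X) ◁
          ((leftAdj X).unit ▷ (dual X ≫ X) ≫
            (dual X ≫ X) ◁ ((rightAdj X).counit ≫ dimR X)) ▷ dual X ⊗≫
          (dual (dual X) ≫ dual X) ◁ (leftAdj X).counit ⊗≫ 𝟙 _ := by
      dsimp only [dualFrob, transposeL, Bicategory.Adjunction.comp, Bicategory.Adjunction.compUnit]
      bicategory
    _ = 𝟙 _ ⊗≫ (leftAdj (dual X)).unit ▷ (X ≫ dual X) ⊗≫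
          dual (dual X) ◁ ((rightAdj X).counit ≫ dimR X) ▷ dual X ⊗≫
          dual (dual X) ◁ leftZigzag (leftAdj X).unit (leftAdj X).counit ⊗≫ 𝟙 _ := by
      rw [← whisker_exchange]; dsimp only [leftZigzag]; bicategory
    _ = 𝟙 _ ⊗≫ (toDoubleL X ▷ 𝟙 b ≫ dual (dual X) ◁ dimR X) ▷ dual X ⊗≫ 𝟙 _ := by
      rw [(leftAdj X).left_triangle]; dsimp only [toDoubleL, transposeL]; bicategory
    _ = _ := by
      rw [← whisker_exchange]; bicategory

theorem dualFrob_transposeR (X : a ⟶ b) [IsIso (dimR X)] :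
    transposeR ((rightAdj X).comp (rightAdj (dual X)))
        ((dualFrob X).mul ≫ (dualFrob X).counit) =
      𝟙 _ ⊗≫ X ◁ dimR X ▷ dual X ⊗≫ toDoubleR X ▷ dual X := by
  calc
    _ = 𝟙 _ ⊗≫ (X ≫ dual X) ◁ (rightAdj X).unit ⊗≫ X ◁ ((dual X ≫ X) ◁ (rightAdj (dual X)).unit ≫
          ((rightAdj X).counit ≫ dimR X) ▷ (dual X ≫ dual (dual X))) ▷ dual X ⊗≫
          (leftAdj X).counit ▷ (dual (dual X) ≫ dual X) ⊗≫ 𝟙 _ := by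
      dsimp only [dualFrob, transposeR, Bicategory.Adjunction.comp, Bicategory.Adjunction.compUnit]
      bicategory
    _ = 𝟙 _ ⊗≫ X ◁ rightZigzag (rightAdj X).unit (rightAdj X).counit ⊗≫ X ◁ dimR X ▷ dual X ⊗≫
          X ◁ (rightAdj (dual X)).unit ▷ dual X ⊗≫
          (leftAdj X).counit ▷ (dual (dual X) ≫ dual X) ⊗≫ 𝟙 _ := by
      rw [whisker_exchange]; dsimp only [rightZigzag]; bicategory
    _ = _ := by
      rw [(rightAdj X).right_triangle]; dsimp only [toDoubleR, transposeR]; bicategory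

/-- The equation into `(X ≫ X†)†` may be tested after the invertible comparison with `X†† ≫ X†`,
where both transposes have been computed. -/
theorem dualFrob_isSymmetric (X : a ⟶ b) [IsIso (dimR X)] : (dualFrob X).IsSymmetric := by
  rw [FrobData.isSymmetric_iff, ← cancel_mono (transposeR ((rightAdj X).comp
    (rightAdj (dual X))) (rightAdj (X ≫ dual X)).counit), transposeR_trans, transpose_comp_counit,
    transposeL_trans, dualFrob_transposeL, dualFrob_transposeR, toDoubleR_eq_toDoubleL]

end Pivotal

theorem dualFrob_isFrobenius {B : Type u} [Bicategory.{w, v} B] [PivotalBicategory B] {a b : B}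
    (X : a ⟶ b) [IsIso (dimR X)] : (dualFrob X).IsFrobenius := by
  rw [dualFrob_eq_ambiFrob]; exact ambiFrob_isFrobenius _ _

theorem dualFrob_isSeparable {B : Type u} [Bicategory.{w, v} B] [PivotalBicategory B] {a b : B}
    (X : a ⟶ b) [IsIso (dimR X)] : (dualFrob X).IsSeparable := by
  rw [dualFrob_eq_ambiFrob]
  refine ambiFrob_isSeparable _ _ ?_
  change (inv (dimR X) ≫ (leftAdj X).unit) ≫ (rightAdj X).counit = _
  rw [Category.assoc]
  exact IsIso.inv_hom_id (dimR X)

/-! ### Recognising relative tensor products -/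

namespace EqCompletion

variable {B : Type u} [Bicategory.{w, v} B] {S T U : EqCompletion B}
  [∀ a b : B, IsIdempotentComplete (a ⟶ b)]

/-- A bimodule `P` whose underlying 1-morphism splits the idempotent `idem M N` is isomorphic to
`tens M N`, provided that the induced map `P ⟶ tens M N` commutes with the actions. -/
noncomputable def isoTens (M : Bimod S T) (N : Bimod T U) (P : Bimod S U)
    (f : P.obj ⟶ M.obj ≫ N.obj) (g : M.obj ≫ N.obj ⟶ P.obj) (hfg : f ≫ idem M N ≫ g = 𝟙 _)
    (hgf : idem M N = g ≫ f)
    (hS : P.actS ≫ f ≫ π M N = S.alg ◁ f ≫ (α_ _ _ _).inv ≫ M.actS ▷ N.obj ≫ π M N)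
    (hT : P.actT ≫ f ≫ π M N = f ▷ U.alg ≫ (α_ _ _ _).hom ≫ M.obj ◁ N.actT ≫ π M N) :
    P ≅ tens M N :=
  isoMk { hom := f ≫ π M N
          actS_comm := by rw [hS, whiskerLeft_comp, Category.assoc, π_actS]
          actT_comm := by rw [hT, comp_whiskerRight, Category.assoc, π_actT] }
    -- As `π ≫ ι` is the idempotent, the round trip on `P` is `f ≫ idem M N ≫ g`, and the one on
    -- `tens M N` is `ι ≫ idem M N ≫ π`.
    (ι M N ≫ g)
    (by
      dsimp only
      rw [Category.assoc, reassoc_of% (π_ι M N), hfg])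
    (by
      dsimp only
      rw [Category.assoc, ← reassoc_of% hgf, idem_π, ι_π])

end EqCompletion

end Orbifold

/-- Let `B` be a pivotal bicategory with idempotent complete hom-categories and let `X : a ⟶ b` have
invertible right quantum dimension.  Then `A = X† ⊗ X` is a symmetric separable Frobenius algebra,
`X` and `X†` are bimodules over `A` and `I_b`, and they are the two 1-morphisms of an adjoint
equivalence between `(a, A)` and `(b, I_b)` in the equivariant and in the orbifold completion. -/
theorem theorem4p7 {B : Type u} [Bicategory.{w, v} B] [PivotalBicategory B]
    [∀ a b : B, IsIdempotentComplete (a ⟶ b)] {a b : B} (X : a ⟶ b) [IsIso (dimR X)] :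
    ∃ (hF : (dualFrob X).IsFrobenius) (hs : (dualFrob X).IsSeparable)
      (hsym : (dualFrob X).IsSymmetric) (hI : (FrobData.unit b).IsSymmetric)
      (hX : IsBimodule (dualFrob X) (FrobData.unit b) X (evalAct X) (ρ_ X).hom)
      (hX' : IsBimodule (FrobData.unit b) (dualFrob X) (dual X) (λ_ (dual X)).hom (evalActDual X)),
      let S : EqCompletion B := ⟨a, X ≫ dual X, dualFrob X, hF, hs⟩
      let T : EqCompletion B := EqCompletion.ofObj B b
      let M : S ⟶ T := (⟨X, evalAct X, (ρ_ X).hom, hX⟩ : EqCompletion.Bimod S T)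
      let N : T ⟶ S := (⟨dual X, (λ_ (dual X)).hom, evalActDual X, hX'⟩ : EqCompletion.Bimod T S)
      (∃ e : Bicategory.Equivalence S T, e.hom = M ∧ e.inv = N) ∧
      (∃ e : Bicategory.Equivalence (B := OrbCompletion B) ⟨S, hsym⟩ ⟨T, hI⟩,
        e.hom = InducedBicategory.mkHom M ∧ e.inv = InducedBicategory.mkHom N) := by
  refine ⟨dualFrob_isFrobenius X, dualFrob_isSeparable X, dualFrob_isSymmetric X,
    unit_isSymmetric b, isBimodule_left (rightAdj X) (rescaledAdj X),
    isBimodule_right (rightAdj X) (rescaledAdj X), ?_⟩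
  intro S T M N
  have hMN : EqCompletion.idem M N = 𝟙 (X ≫ dual X) := relIdem_unit (dual X)
  have hNM : EqCompletion.idem N M = (rightAdj X).counit ≫ inv (dimR X) ≫ (leftAdj X).unit :=
    relIdem_ambiFrob (rightAdj X) (rescaledAdj X)
  -- The product of `A` acts on `X ≫ X†` through its outer factors, so the identity of `X ≫ X†`
  -- respects both actions.
  have hη {Z : a ⟶ a} (p : X ≫ dual X ⟶ Z) : (dualFrob X).mul ≫ 𝟙 _ ≫ p =
      (X ≫ dual X) ◁ 𝟙 _ ≫ (α_ _ _ _).inv ≫ evalAct X ▷ dual X ≫ p := by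
    dsimp only [dualFrob, evalAct]; bicategory
  have hη' {Z : a ⟶ a} (p : X ≫ dual X ⟶ Z) : (dualFrob X).mul ≫ 𝟙 _ ≫ p =
      𝟙 _ ▷ (X ≫ dual X) ≫ (α_ _ _ _).hom ≫ X ◁ evalActDual X ≫ p := by
    dsimp only [dualFrob, evalActDual]; bicategory
  have hε {Z : b ⟶ b} (u : 𝟙 b ⟶ dual X ≫ X) (p : dual X ≫ X ⟶ Z) : (λ_ (𝟙 b)).hom ≫ u ≫ p =
      𝟙 b ◁ u ≫ (α_ _ _ _).inv ≫ (λ_ (dual X)).hom ▷ X ≫ p := by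
    bicategory
  have hε' {Z : b ⟶ b} (u : 𝟙 b ⟶ dual X ≫ X) (p : dual X ≫ X ⟶ Z) : (λ_ (𝟙 b)).hom ≫ u ≫ p =
      u ▷ 𝟙 b ≫ (α_ _ _ _).hom ≫ dual X ◁ (ρ_ X).hom ≫ p := by
    bicategory
  -- The loop evaluates to `d⁻¹ d d⁻¹ d` with `d = dimR X`.
  have hd : (inv (dimR X) ≫ (leftAdj X).unit) ≫ ((rightAdj X).counit ≫ inv (dimR X) ≫
      (leftAdj X).unit) ≫ (rightAdj X).counit = 𝟙 (𝟙 b) := by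
    have h : (leftAdj X).unit ≫ (rightAdj X).counit = dimR X := rfl
    simp only [Category.assoc, h, IsIso.inv_hom_id, Category.comp_id]
  let unitIso : EqCompletion.idHom S ≅ EqCompletion.tens M N :=
    EqCompletion.isoTens M N (EqCompletion.idHom S) (𝟙 (X ≫ dual X)) (𝟙 (X ≫ dual X))
      (by rw [hMN]; exact (Category.id_comp _).trans (Category.id_comp _))
      (hMN.trans (Category.id_comp _).symm) (hη (EqCompletion.π M N)) (hη' (EqCompletion.π M N))
  let counitIso : EqCompletion.idHom T ≅ EqCompletion.tens N M :=
    EqCompletion.isoTens N M (EqCompletion.idHom T)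
      (inv (dimR X) ≫ (leftAdj X).unit : 𝟙 b ⟶ dual X ≫ X) (rightAdj X).counit
      (by rw [hNM]; exact hd) hNM (hε _ (EqCompletion.π N M)) (hε' _ (EqCompletion.π N M))
  -- No triangle identity has to be checked: the unit is kept and the counit is replaced by a
  -- corrected one. The same 2-isomorphisms serve in `B_orb`.
  exact ⟨⟨Bicategory.Equivalence.mkOfAdjointifyCounit (f := M) (g := N) unitIso counitIso.symm,
      rfl, rfl⟩,
    ⟨Bicategory.Equivalence.mkOfAdjointifyCounit (B := OrbCompletion B)
      (a := ⟨S, dualFrob_isSymmetric X⟩) (b := ⟨T, unit_isSymmetric b⟩)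
      (f := InducedBicategory.mkHom M) (g := InducedBicategory.mkHom N)
      (InducedBicategory.isoMk unitIso) (InducedBicategory.isoMk counitIso.symm), rfl, rfl⟩⟩
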